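/- Let $M,K,N\ge 1$ be integers with $\gcd(M,K)=1$ and $\gcd(M+K,N)=1$. Let $I_n^t,V_n^t\in\mathbb C$ $(n,t\in\mathbb Z$; the superscript is a time index$)$, with all $I_n^t\neq 0$, satisfy $$I_n^t=I_{n-1}^{t-M}+V_n^{t-K}-V_{n-1}^t,\qquad V_n^t=\frac{I_n^{t-M}V_n^{t-K}}{I_n^t},\qquad I_{n+N}^t=I_n^t,\quad V_{n+N}^t=V_n^t .$$ Let $S(y)$ be the $N\times N$ matrix with ones on the superdiagonal, $y$ in the lower left corner and zeros elsewhere ($S(y)=(y)$ if $N=1$), put $L_t(y)=\mathrm{diag}(V_1^t,\dots,V_N^t)+S(y)$, $R_t(y)=\mathrm{diag}(I_1^t,\dots,I_N^t)+S(y)$ and $$X_t(y)=L_{t-(K-1)M}(y)\cdots L_{t-M}(y)L_t(y)\,R_t(y)R_{t-K}(y)\cdots R_{t-(M-1)K}(y).$$ Assume that the affine curve $\widetilde C=\{(x,y)\in\mathbb C^2 : \det(X_t(y)-xE)=0\}$ (it does not depend on $t$) is smooth, that is, the two partial derivatives of $\det(X_t(y)-xE)$ do not vanish simultaneously at any point of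 it, and let $C$, the spectral curve, be its smooth completion. Then: (i), (ii) $C$ has $M$ points $A_j$ with $(x,y)=\bigl(0,(-1)^N\prod_{n=1}^N I_n^{-jK}\bigr)$, $0\le j\le M-1$, and $K$ points $B_j$ with $(x,y)=\bigl(0,(-1)^N\prod_{n=1}^N V_n^{-jM}\bigr)$, $0\le j\le K-1$. Each is the only point of $C$ with these coordinates, and, counted with multiplicity, they are all the zeros of $x$: $(x)_0=\sum_j A_j+\sum_j B_j$. (iii) Put $U_j=\prod_{k=1}^K V_j^{s-k}\cdot\prod_{k=1}^M I_j^{s-k}$; this does not depend on $s\in\mathbb Z$. Then $C$ has $N$ points $Q_j$ with $(x,y)=(U_j,0)$, $1\le j\le N$. Each is the only point of $C$ with these coordinates, and $(y)_0=\sum_j Q_j$. (iv) There is a point $P\in C$ at which both $x$ and $y$ have a pole, and $P$ is the only point of $C$ at which $x$ or $y$ has a pole. There is a local coordinate $k$ at $P$ with $$x=k^{-(M+K)}+\cdots,\qquad y=k^{-N}+\cdots,$$ the dots being terms of higher order in $k$. For every $s\in\mathbb Z$ there is a nonzero vector $v$ of rational functions on $C$ with $X_s(y)v=x\,v$, and every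 such $v=(v_1,\dots,v_N)^T$ satisfies, after multiplication by a suitable nonzero rational function, $v_i=k^{N-i}+(\text{higher order terms in }k)$ at $P$ for $i=1,\dots,N$, that is, $v\sim(k^{N-1},\dots,k,1)^T$. -/

import Mathlib

open Polynomial
open scoped WithZero

noncomputable section

namespace RndKP

/-- A solution of the `(M,K)`-reduced non-autonomous discrete KP equation with period `N`;
`I n t` and `V n t` stand for `I_n^t` and `V_n^t`. Since the equation divides by `I_n^t`, these
numbers are nonzero. -/
structure IsSolution (M K N : ℕ) (I V : ℤ → ℤ → ℂ) : Prop where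
  I_ne_zero : ∀ n t, I n t ≠ 0
  eq_I : ∀ n t, I n t = I (n - 1) (t - M) + V n (t - K) - V (n - 1) t
  eq_V : ∀ n t, V n t = I n (t - M) * V n (t - K) / I n t
  I_periodic : ∀ n t, I (n + N) t = I n t
  V_periodic : ∀ n t, V (n + N) t = V n t

/-- The matrix `S(y)`, with ones above the diagonal and `y` in the lower left corner
(for `N = 1` it is the `1 × 1` matrix `(y)`). The variable of `ℂ[X]` is `y`. -/
def shiftMatrix (N : ℕ) : Matrix (Fin N) (Fin N) ℂ[X] := fun i j =>
  if (i : ℕ) + 1 = j then 1 else if (i : ℕ) + 1 = N ∧ (j : ℕ) = 0 then X else 0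

/-- The matrix `diag(d_1, …, d_N) + S(y)`. It is `L_t(y)` for `d_n = V_n^t` and `R_t(y)` for
`d_n = I_n^t`. -/
def bidiagonal (N : ℕ) (d : ℤ → ℂ) : Matrix (Fin N) (Fin N) ℂ[X] :=
  Matrix.diagonal (fun i : Fin N => C (d ((i : ℤ) + 1))) + shiftMatrix N

/-- `X_t(y) = L_{t-(K-1)M}(y) ⋯ L_{t-M}(y) L_t(y) R_t(y) R_{t-K}(y) ⋯ R_{t-(M-1)K}(y)`. -/
def laxMatrix (M K N : ℕ) (I V : ℤ → ℤ → ℂ) (t : ℤ) : Matrix (Fin N) (Fin N) ℂ[X] :=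
  ((List.range K).reverse.map fun j : ℕ => bidiagonal N fun n => V n (t - j * M)).prod *
    ((List.range M).map fun j : ℕ => bidiagonal N fun n => I n (t - j * K)).prod

/-- The polynomial `det (x E - X_t(y))` of the affine spectral curve. The outer variable is `x`,
the inner variable is `y`. -/
def spectralPoly (M K N : ℕ) (I V : ℤ → ℤ → ℂ) (t : ℤ) : ℂ[X][X] :=
  (laxMatrix M K N I V t).charpoly

/-- The affine plane curve `F(x, y) = 0` (outer variable `x`, inner variable `y`) is smooth: at no
point `(a, b)` of it do both partial derivatives of `F` vanish. -/
def IsSmoothAffine (F : ℂ[X][X]) : Prop :=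
  ∀ a b : ℂ, F.evalEval b a = 0 →
    (derivative (F.map (evalRingHom b))).eval a ≠ 0 ∨ (derivative (F.eval (C a))).eval b ≠ 0

/-- The ring of rational functions on the affine plane curve `F(x, y) = 0`: the total ring of
fractions of its coordinate ring (the function field, if `F` is irreducible). -/
abbrev RatFun (F : ℂ[X][X]) : Type := FractionRing (AdjoinRoot F)

/-- The coordinate function `x`. -/
def xFun (F : ℂ[X][X]) : RatFun F := algebraMap (AdjoinRoot F) (RatFun F) (AdjoinRoot.root F)

/-- The coordinate function `y`. -/
def yFun (F : ℂ[X][X]) : RatFun F := algebraMap (AdjoinRoot F) (RatFun F) (AdjoinRoot.of F X)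

/-- The points of the smooth complete curve that has the same rational functions as the plane
curve `F(x, y) = 0`: the normalised discrete valuations of the ring of rational functions that are
trivial on the constants. The valuation is written multiplicatively: `val f = exp (-n)` means
that `f` has order `n` at the point, and `val f = 0` means that `f` vanishes identically on the
component of the point. -/
@[ext]
structure CurvePoint (F : ℂ[X][X]) where
  val : Valuation (RatFun F) ℤᵐ⁰
  surjective : Function.Surjective val
  val_const : ∀ c : ℂ, c ≠ 0 → val (algebraMap ℂ (RatFun F) c) = 1

namespace CurvePoint

variable {F : ℂ[X][X]}

/-- The rational function `f` is regular at `p` with value `c`. -/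
def HasValue (p : CurvePoint F) (f : RatFun F) (c : ℂ) : Prop :=
  p.val (f - algebraMap ℂ (RatFun F) c) < 1

/-- The rational function `f` has a pole at `p`, that is, `f(p) = ∞`. -/
def HasPole (p : CurvePoint F) (f : RatFun F) : Prop := 1 < p.val f

/-- The rational function `f` has order exactly `n` at `p`. -/
def HasOrder (p : CurvePoint F) (f : RatFun F) (n : ℤ) : Prop := p.val f = WithZero.exp (-n)

/-- `f = g + (terms of higher order)` at `p`. -/
def LeadingTerm (p : CurvePoint F) (f g : RatFun F) : Prop := p.val (f - g) < p.val g

/-- `p` is the point `(x, y) = (a, b)`: it has these coordinates, and no other point has them. -/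
def IsPointAt (p : CurvePoint F) (a b : ℂ) : Prop :=
  (p.HasValue (xFun F) a ∧ p.HasValue (yFun F) b) ∧
    ∀ q : CurvePoint F, q.HasValue (xFun F) a → q.HasValue (yFun F) b → q = p

end CurvePoint

/-- `w` is a nonzero vector of rational functions on `F(x, y) = 0` with `Z(y) w = x w`. -/
def IsEigenvector (F : ℂ[X][X]) {N : ℕ} (Z : Matrix (Fin N) (Fin N) ℂ[X]) (w : Fin N → RatFun F) :
    Prop :=
  w ≠ 0 ∧ (Z.map (algebraMap ℂ[X] (RatFun F))).mulVec w = xFun F • w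

end RndKP

end

/-!
The relation `L_t R_t = R_{t-M} L_{t-K}` makes `det (x E - X_t(y))` periodic in `t` with the coprime
periods `M` and `K`, hence constant. Conjugation by `diag(1, z, …, z^{N-1})` shows that it equals
`x ^ N - y ^ (M + K)` plus terms of lower weight, where `x` has weight `M + K` and `y` has weight
`N`: the curve is a `C_ab` curve. As the weights are coprime, the functions `x ^ i y ^ j`, `i < N`,
have distinct orders at every pole of `y`, so the orders of `x` and `y` determine the valuation and
there is at most one pole; Hensel's lemma gives one, with values in Laurent series.

At `x = 0` the polynomial becomes, up to sign, the product of the determinants of the factors of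
`X_0`, and at `y = 0` these factors become triangular. This gives the coordinates of the zeros. On a
smooth affine curve each solution of `F(x, y) = 0` is exactly one point, and the multiplicity of a
zero is the multiplicity of the corresponding root.

A local coordinate at infinity is `κ = x ^ (-α) y ^ (-β)` with `α (M + K) + β N = 1`. If `w` is an
eigenvector, then for `u_i = κ ^ i w_i` the eigenvalue equation reduces to invariance of the leading
terms under the cyclic shift by `M + K`, so all `u_i` have the same leading term.
-/

noncomputable section

namespace RndKP

section CyclicBidiagonal

variable {R S : Type*} [CommRing R] [CommRing S] {N : ℕ}

/-- The matrix `diag(d) + S(y)` over an arbitrary commutative ring. -/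
def cyclicBidiagonal (d : Fin N → R) (y : R) : Matrix (Fin N) (Fin N) R :=
  Matrix.diagonal d + Matrix.of fun i j : Fin N =>
    if (i : ℕ) + 1 = j then 1 else if (i : ℕ) + 1 = N ∧ (j : ℕ) = 0 then y else 0

/-- The product of the matrices `diag(d) + S(y)`, where `d` runs through a list. -/
def cyclicProd (ds : List (Fin N → R)) (y : R) : Matrix (Fin N) (Fin N) R :=
  (ds.map (cyclicBidiagonal · y)).prod

theorem val_add_one_eq_ite [NeZero N] (i : Fin N) :
    ((i + 1 : Fin N) : ℕ) = if (i : ℕ) + 1 = N then 0 else (i : ℕ) + 1 := by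
  obtain ⟨n, rfl⟩ := Nat.exists_eq_succ_of_ne_zero (NeZero.ne N)
  simp only [Fin.val_add_one, Fin.ext_iff, Fin.val_last, Nat.succ_eq_add_one,
    Nat.add_right_cancel_iff]

theorem cyclicBidiagonal_apply [NeZero N] (d : Fin N → R) (y : R) (i j : Fin N) :
    cyclicBidiagonal d y i j = (if i = j then d i else 0) +
      if j = i + 1 then (if (i : ℕ) + 1 = N then y else 1) else 0 := by
  simp only [cyclicBidiagonal, Matrix.add_apply, Matrix.diagonal_apply, Matrix.of_apply,
    Fin.ext_iff (a := j), val_add_one_eq_ite]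
  grind

theorem cyclicBidiagonal_mulVec [NeZero N] (d : Fin N → R) (y : R) (u : Fin N → R) (i : Fin N) :
    (cyclicBidiagonal d y).mulVec u i =
      d i * u i + (if (i : ℕ) + 1 = N then y else 1) * u (i + 1) := by
  simp [Matrix.mulVec, dotProduct, cyclicBidiagonal_apply, add_mul, Finset.sum_add_distrib]

theorem cyclicBidiagonal_map (f : R →+* S) (d : Fin N → R) (y : R) :
    (cyclicBidiagonal d y).map f = cyclicBidiagonal (f ∘ d) (f y) := by
  ext i j
  simp only [cyclicBidiagonal, Matrix.map_apply, Matrix.add_apply, Matrix.diagonal_apply,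
    Matrix.of_apply, map_add, apply_ite f, map_zero, map_one, Function.comp_apply]

theorem cyclicProd_map (f : R →+* S) (ds : List (Fin N → R)) (y : R) :
    (cyclicProd ds y).map f = cyclicProd (ds.map (f ∘ ·)) (f y) := by
  simp only [cyclicProd, ← RingHom.mapMatrix_apply, map_list_prod, List.map_map]
  exact congrArg List.prod (List.map_congr_left fun d _ => cyclicBidiagonal_map f d y)

theorem charpoly_cyclicProd_map (f : R →+* S) (ds : List (Fin N → R)) (y : R) :
    (cyclicProd ds y).charpoly.map f = (cyclicProd (ds.map (f ∘ ·)) (f y)).charpoly := by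
  rw [← Matrix.charpoly_map, cyclicProd_map]

theorem cyclicBidiagonal_mul_diagonal {z κ : R} (h : κ * z = 1) (d : Fin N → R) (y : R) :
    cyclicBidiagonal d y * Matrix.diagonal (fun i : Fin N => z ^ (i : ℕ)) =
      z • (Matrix.diagonal (fun i : Fin N => z ^ (i : ℕ)) *
        cyclicBidiagonal (κ • d) (y * κ ^ N)) := by
  have hpow (n : ℕ) : κ ^ n * z ^ n = 1 := by rw [← mul_pow, h, one_pow]
  ext i j
  have : NeZero N := ⟨i.pos.ne'⟩
  simp only [Matrix.smul_apply, Matrix.mul_diagonal, Matrix.diagonal_mul, cyclicBidiagonal_apply,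
    smul_eq_mul, add_mul, mul_add, ite_mul, mul_ite, zero_mul, mul_zero, Pi.smul_apply]
  congr 1
  · split_ifs with hij
    · rw [← hij]
      linear_combination -(d i * z ^ (i : ℕ)) * h
    · rfl
  · split_ifs with hj hi
    · have hz : z ^ N = z ^ (i : ℕ) * z := by rw [← pow_succ, hi]
      rw [hj, val_add_one_eq_ite, if_pos hi, pow_zero]
      linear_combination -y * hpow N + y * κ ^ N * hz
    · rw [hj, val_add_one_eq_ite, if_neg hi, pow_succ]
      ring
    · rfl

theorem cyclicProd_mul_diagonal {z κ : R} (h : κ * z = 1) (ds : List (Fin N → R)) (y : R) :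
    cyclicProd ds y * Matrix.diagonal (fun i : Fin N => z ^ (i : ℕ)) =
      z ^ ds.length • (Matrix.diagonal (fun i : Fin N => z ^ (i : ℕ)) *
        cyclicProd (ds.map (κ • ·)) (y * κ ^ N)) := by
  induction ds with
  | nil => simp [cyclicProd]
  | cons d ds ih =>
    simp only [cyclicProd, List.map_cons, List.prod_cons, List.length_cons] at ih ⊢
    rw [mul_assoc, ih, Matrix.mul_smul, ← mul_assoc, cyclicBidiagonal_mul_diagonal h,
      Matrix.smul_mul, smul_smul, pow_succ, mul_assoc]

theorem charpoly_smul_coeff {c : R} (hc : IsUnit c) (B : Matrix (Fin N) (Fin N) R) {a : ℕ}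
    (ha : a ≤ N) : (c • B).charpoly.coeff a = c ^ (N - a) * B.charpoly.coeff a := by
  have hcomp : (c • B).charpoly.comp (C c * X) = C (c ^ N) * B.charpoly := by
    have hmat : (eval₂RingHom C (C c * X)).mapMatrix (c • B).charmatrix = C c • B.charmatrix := by
      ext1 i j
      rcases eq_or_ne i j with rfl | hij
      · simp [Matrix.charmatrix_apply_eq, mul_sub]
      · simp [Matrix.charmatrix_apply_ne _ _ _ hij]
    rw [Matrix.charpoly, Matrix.charpoly, Polynomial.comp, ← coe_eval₂RingHom, RingHom.map_det,
      hmat, Matrix.det_smul, Fintype.card_fin, C_pow]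
  have hcoeff := congrArg (coeff · a) hcomp
  simp only [comp_C_mul_X_coeff, coeff_C_mul] at hcoeff
  apply (hc.pow a).mul_right_cancel
  rw [hcoeff, mul_right_comm, ← pow_add, Nat.sub_add_cancel ha]

theorem charpoly_cyclicProd_coeff {z κ : R} (h : κ * z = 1) (ds : List (Fin N → R)) (y : R)
    {a : ℕ} (ha : a ≤ N) :
    (cyclicProd ds y).charpoly.coeff a = z ^ (ds.length * (N - a)) *
      (cyclicProd (ds.map (κ • ·)) (y * κ ^ N)).charpoly.coeff a := by
  have hz : IsUnit z := IsUnit.of_mul_eq_one_right κ h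
  set D : Matrix (Fin N) (Fin N) R := Matrix.diagonal fun i => z ^ (i : ℕ)
  set E : Matrix (Fin N) (Fin N) R := Matrix.diagonal fun i => κ ^ (i : ℕ)
  have hED : E * D = 1 := by simp [E, D, Matrix.diagonal_mul_diagonal, ← mul_pow, h]
  calc (cyclicProd ds y).charpoly.coeff a
      = (cyclicProd ds y * D * E).charpoly.coeff a := by
        rw [mul_assoc, mul_eq_one_comm.1 hED, mul_one]
    _ = (z ^ ds.length • cyclicProd (ds.map (κ • ·)) (y * κ ^ N)).charpoly.coeff a := by
        rw [cyclicProd_mul_diagonal h, Matrix.charpoly_mul_comm, Matrix.mul_smul, ← mul_assoc, hED,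
          one_mul]
    _ = _ := by rw [charpoly_smul_coeff (hz.pow _) _ ha, pow_mul]

theorem cyclicBidiagonal_blockTriangular (d : Fin N → R) :
    (cyclicBidiagonal d 0).BlockTriangular id := by
  intro i j (hij : j < i)
  have hne : (i : ℕ) + 1 ≠ j := by omega
  simp [cyclicBidiagonal, hij.ne', hne]

theorem cyclicBidiagonal_zero_apply_self (d : Fin N → R) (i : Fin N) :
    cyclicBidiagonal d 0 i i = d i := by
  simp [cyclicBidiagonal]

theorem det_updateRow_cyclicBidiagonal {n : ℕ} (d : Fin (n + 1) → R) :
    ((cyclicBidiagonal d 0).updateRow (Fin.last n) (Pi.single 0 1)).det = (-1) ^ n := by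
  let W : Matrix (Fin (n + 1)) (Fin (n + 1)) R :=
    Matrix.of (Fin.cons (Pi.single 0 1) fun i => cyclicBidiagonal d 0 i.castSucc)
  have hrot : (cyclicBidiagonal d 0).updateRow (Fin.last n) (Pi.single 0 1) =
      W.submatrix (finRotate (n + 1)) id := by
    ext i j
    cases i using Fin.lastCases with
    | last => simp [W]
    | cast i => simp [W, Matrix.updateRow_ne, Fin.castSucc_ne_last]
  have hW : W.det = 1 := by
    rw [Matrix.det_of_isLowerTriangular]
    · refine Finset.prod_eq_one fun i _ => ?_
      cases i using Fin.cases with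
      | zero => simp [W]
      | succ i => simp [W, cyclicBidiagonal, Matrix.diagonal_apply_ne _ (Fin.castSucc_lt_succ.ne)]
    · intro i j (hij : i < j)
      cases i using Fin.cases with
      | zero => simp [W, hij.ne']
      | succ i =>
        have hlt := Fin.lt_def.1 hij
        rw [Fin.val_succ] at hlt
        have hne : i.castSucc ≠ j := fun h => by simp [← h] at hlt
        simp [W, cyclicBidiagonal, Matrix.diagonal_apply_ne _ hne, hlt.ne]
  rw [hrot, Matrix.det_permute, hW, sign_finRotate]
  simp

theorem det_cyclicBidiagonal [NeZero N] (d : Fin N → R) (y : R) :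
    (cyclicBidiagonal d y).det = ∏ i, d i - (-1) ^ N * y := by
  obtain ⟨n, rfl⟩ := Nat.exists_eq_succ_of_ne_zero (NeZero.ne N)
  have hrow : cyclicBidiagonal d y = (cyclicBidiagonal d 0).updateRow (Fin.last n)
      (cyclicBidiagonal d 0 (Fin.last n) + y • Pi.single 0 1) := by
    ext i j
    rcases eq_or_ne i (Fin.last n) with rfl | hi
    · simp [cyclicBidiagonal_apply, Pi.single_apply]
    · have : (i : ℕ) ≠ n := fun h => hi (Fin.ext h)
      simp [cyclicBidiagonal_apply, hi, this, Matrix.updateRow_ne]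
  rw [hrow, Matrix.det_updateRow_add, Matrix.det_updateRow_smul, Matrix.updateRow_eq_self,
    det_updateRow_cyclicBidiagonal,
    Matrix.det_of_isUpperTriangular (cyclicBidiagonal_blockTriangular d)]
  simp only [cyclicBidiagonal_zero_apply_self, Nat.succ_eq_add_one]
  ring

theorem det_cyclicProd [NeZero N] (ds : List (Fin N → R)) (y : R) :
    (cyclicProd ds y).det = (ds.map fun d => ∏ i, d i - (-1) ^ N * y).prod := by
  rw [cyclicProd, ← Matrix.coe_detMonoidHom, map_list_prod, List.map_map]
  exact congrArg List.prod (List.map_congr_left fun d _ => det_cyclicBidiagonal d y)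

theorem cyclicProd_zero_right (ds : List (Fin N → R)) :
    (cyclicProd ds 0).BlockTriangular id ∧ ∀ i, cyclicProd ds 0 i i = (ds.map (· i)).prod := by
  induction ds with
  | nil => simpa [cyclicProd] using Matrix.blockTriangular_one
  | cons d ds ih =>
    obtain ⟨htri, hdiag⟩ := ih
    have hd := cyclicBidiagonal_blockTriangular d
    rw [show cyclicProd (d :: ds) 0 = cyclicBidiagonal d 0 * cyclicProd ds 0 by simp [cyclicProd]]
    refine ⟨hd.mul htri, fun i => ?_⟩
    rw [Matrix.mul_apply, Finset.sum_eq_single_of_mem i (Finset.mem_univ i), hdiag,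
      cyclicBidiagonal_zero_apply_self, List.map_cons, List.prod_cons]
    intro j _ hj
    rcases lt_or_gt_of_ne hj with h | h
    · rw [hd h, zero_mul]
    · rw [htri h, mul_zero]

theorem charpoly_cyclicProd_zero_right (ds : List (Fin N → R)) :
    (cyclicProd ds 0).charpoly = ∏ i, (X - C (ds.map (· i)).prod) := by
  rw [Matrix.charpoly_of_isUpperTriangular _ (cyclicProd_zero_right ds).1]
  simp only [(cyclicProd_zero_right ds).2]

theorem charpoly_cyclicBidiagonal_zero [NeZero N] (y : R) :
    (cyclicBidiagonal (0 : Fin N → R) y).charpoly = X ^ N - C y := by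
  have hmat : (cyclicBidiagonal (0 : Fin N → R) y).charmatrix =
      -cyclicBidiagonal (fun _ => -X) (C y) := by
    ext1 i j
    rw [Matrix.charmatrix, RingHom.mapMatrix_apply, cyclicBidiagonal_map]
    simp only [cyclicBidiagonal, Matrix.sub_apply, Matrix.scalar_apply, Matrix.diagonal_apply,
      Matrix.neg_apply, Matrix.add_apply, Function.comp_apply, Pi.zero_apply, map_zero, ite_self,
      zero_add]
    split_ifs <;> ring
  have hsq : ((-1 : R[X]) ^ N) * (-1) ^ N = 1 := by rw [← mul_pow, neg_one_mul, neg_neg, one_pow]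
  rw [Matrix.charpoly, hmat, Matrix.det_neg, det_cyclicBidiagonal, Fintype.card_fin,
    Finset.prod_const, Finset.card_univ, Fintype.card_fin, neg_pow (X : R[X])]
  linear_combination (X ^ N - C y) * hsq

theorem cyclicBidiagonal_zero_one_pow [NeZero N] (m : ℕ) :
    cyclicBidiagonal (0 : Fin N → R) 1 ^ m =
      (Equiv.addRight (m • (1 : Fin N))).permMatrix R := by
  have hone : cyclicBidiagonal (0 : Fin N → R) 1 = (Equiv.addRight (1 : Fin N)).permMatrix R := by
    ext i j
    simp [cyclicBidiagonal_apply, PEquiv.toMatrix_apply, eq_comm]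
  induction m with
  | zero => ext i j; simp [Matrix.one_apply, PEquiv.toMatrix_apply]
  | succ m ih =>
    rw [pow_succ, ih, hone, ← Matrix.permMatrix_mul, add_nsmul, one_nsmul, Equiv.addRight_add]

theorem charpoly_cyclicBidiagonal_zero_one_pow [NeZero N] {m : ℕ} (hm : m.Coprime N) :
    (cyclicBidiagonal (0 : Fin N → R) 1 ^ m).charpoly = X ^ N - 1 := by
  -- Multiplication by `m` permutes `ℤ/N` and conjugates the shift by `1` to the shift by `m`.
  let e : Fin N ≃ Fin N := nsmulCoprime (n := m) (by simpa using hm.symm)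
  have hconj : cyclicBidiagonal (0 : Fin N → R) 1 ^ m =
      Matrix.reindex e e (cyclicBidiagonal 0 1) := by
    refine (Equiv.symm_apply_eq (Matrix.reindex e e)).1 ?_
    rw [← pow_one (cyclicBidiagonal (0 : Fin N → R) 1), ← pow_mul, one_mul,
      cyclicBidiagonal_zero_one_pow, cyclicBidiagonal_zero_one_pow]
    ext i j
    have : e j = e i + m • 1 ↔ j = i + 1 := by
      rw [← e.injective.eq_iff (a := j)]
      simp [e]
    simp [PEquiv.toMatrix_apply, eq_comm (b := e j), eq_comm (b := j), this]
  rw [hconj, Matrix.charpoly_reindex, charpoly_cyclicBidiagonal_zero, map_one]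

theorem cyclicProd_eq_pow {ds : List (Fin N → R)} (hds : ∀ d ∈ ds, d = 0) (y : R) :
    cyclicProd ds y = cyclicBidiagonal 0 y ^ ds.length := by
  rw [cyclicProd, List.prod_eq_pow_card _ (cyclicBidiagonal 0 y), List.length_map]
  simp only [List.mem_map]
  rintro _ ⟨d, hd, rfl⟩
  rw [hds d hd]

end CyclicBidiagonal

section Isospectrality

section Monoid

variable {G : Type*} [Monoid G] {L R : ℤ → G} {M K : ℕ}

/-- The word `L_{t-(K-1)M} ⋯ L_{t-M} L_t R_t R_{t-K} ⋯ R_{t-(M-1)K}` in a monoid. -/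
def laxWord (L R : ℤ → G) (M K : ℕ) (t : ℤ) : G :=
  ((List.range K).reverse.map fun j : ℕ => L (t - j * M)).prod *
    ((List.range M).map fun j : ℕ => R (t - j * K)).prod

theorem mul_prod_map_range_of_commutation (h : ∀ t, L t * R t = R (t - M) * L (t - K))
    (n : ℕ) (t : ℤ) :
    L t * ((List.range n).map fun j : ℕ => R (t - j * K)).prod =
      ((List.range n).map fun j : ℕ => R (t - M - j * K)).prod * L (t - n * K) := by
  induction n with
  | zero => simp
  | succ n ih =>
    simp only [List.range_succ, List.map_append, List.prod_append, List.map_cons, List.map_nil,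
      List.prod_singleton]
    rw [← mul_assoc, ih, mul_assoc, mul_assoc, h, sub_right_comm, sub_sub _ _ (K : ℤ),
      Nat.cast_succ, add_one_mul]

theorem exists_laxWord_eq_mul (h : ∀ t, L t * R t = R (t - M) * L (t - K)) (hK : 0 < K) (t : ℤ) :
    ∃ a l, laxWord L R M K t = a * l ∧ laxWord L R M K (t - M) = l * a := by
  obtain ⟨k, rfl⟩ := Nat.exists_eq_succ_of_ne_zero hK.ne'
  have hshift (j : ℕ) : t - (j + 1) * (M : ℤ) = t - M - j * M := by ring
  refine ⟨((List.range k).reverse.map fun j : ℕ => L (t - M - j * M)).prod *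
    ((List.range M).map fun j : ℕ => R (t - M - j * (k + 1 : ℕ))).prod,
    L (t - M * (k + 1 : ℕ)), ?_, ?_⟩
  · rw [mul_assoc, ← mul_prod_map_range_of_commutation h, laxWord, ← mul_assoc]
    simp [List.range_succ_eq_map, Function.comp_def, hshift]
  · rw [laxWord, ← mul_assoc, mul_comm (M : ℤ), Nat.cast_succ, hshift]
    simp [List.range_succ]

theorem laxWord_op (L R : ℤ → G) (M K : ℕ) (t : ℤ) :
    laxWord (MulOpposite.op ∘ R) (MulOpposite.op ∘ L) K M t =
      MulOpposite.op (laxWord L R M K t) := by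
  simp [laxWord, MulOpposite.op_list_prod, Function.comp_def, List.map_reverse]

end Monoid

theorem eq_of_periodic_of_coprime {α : Type*} {f : ℤ → α} {M K : ℕ} (hMK : M.Coprime K)
    (hM : Function.Periodic f M) (hK : Function.Periodic f K) (s t : ℤ) : f s = f t := by
  obtain ⟨a, b, hab⟩ := Nat.isCoprime_iff_coprime.2 hMK
  have hone : Function.Periodic f 1 := hab ▸ (hM.int_mul a).add_period (hK.int_mul b)
  simpa using hone.int_mul (s - t) t

theorem charpoly_laxWord_eq {R : Type*} [CommRing R] {n : Type*} [Fintype n] [DecidableEq n]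
    {A B : ℤ → Matrix n n R} {M K : ℕ} (hM : 0 < M) (hK : 0 < K) (hMK : M.Coprime K)
    (h : ∀ t, A t * B t = B (t - M) * A (t - K)) (s t : ℤ) :
    (laxWord A B M K s).charpoly = (laxWord A B M K t).charpoly := by
  refine eq_of_periodic_of_coprime (f := fun t => (laxWord A B M K t).charpoly) hMK ?_ ?_ s t
  · intro t
    obtain ⟨a, l, h₁, h₂⟩ := exists_laxWord_eq_mul h hK (t + M)
    rw [add_sub_cancel_right] at h₂
    dsimp only
    rw [h₁, h₂, Matrix.charpoly_mul_comm]
  · intro t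
    obtain ⟨a, l, h₁, h₂⟩ := exists_laxWord_eq_mul (L := MulOpposite.op ∘ B)
      (R := MulOpposite.op ∘ A) (fun t => congrArg MulOpposite.op (h t)) hM (t + K)
    rw [laxWord_op] at h₁ h₂
    rw [add_sub_cancel_right] at h₂
    have h₁' := congrArg MulOpposite.unop h₁
    have h₂' := congrArg MulOpposite.unop h₂
    simp only [MulOpposite.unop_op, MulOpposite.unop_mul] at h₁' h₂'
    dsimp only
    rw [h₁', h₂', Matrix.charpoly_mul_comm]

variable {M K N : ℕ} {I V : ℤ → ℤ → ℂ}

theorem IsSolution.V_mul_I (h : IsSolution M K N I V) (n t : ℤ) :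
    V n t * I n t = I n (t - M) * V n (t - K) := by
  rw [h.eq_V n t, div_mul_cancel₀ _ (h.I_ne_zero n t)]

theorem IsSolution.bidiagonal_mul (h : IsSolution M K N I V) (t : ℤ) :
    (bidiagonal N fun n => V n t) * (bidiagonal N fun n => I n t) =
      (bidiagonal N fun n => I n (t - M)) * (bidiagonal N fun n => V n (t - K)) := by
  have hsum (n : ℤ) : V n t + I (n + 1) t = I n (t - M) + V (n + 1) (t - K) := by
    rw [h.eq_I (n + 1) t, add_sub_cancel_right]
    ring
  have hI (s : ℤ) : I (N + 1) s = I 1 s := by rw [add_comm, h.I_periodic]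
  have hV (s : ℤ) : V (N + 1) s = V 1 s := by rw [add_comm, h.V_periodic]
  have hshift : Matrix.diagonal (fun i : Fin N => C (V ((i : ℤ) + 1) t)) * shiftMatrix N +
      shiftMatrix N * Matrix.diagonal (fun i : Fin N => C (I ((i : ℤ) + 1) t)) =
      Matrix.diagonal (fun i : Fin N => C (I ((i : ℤ) + 1) (t - M))) * shiftMatrix N +
      shiftMatrix N * Matrix.diagonal (fun i : Fin N => C (V ((i : ℤ) + 1) (t - K))) := by
    ext1 i j
    simp only [Matrix.add_apply, Matrix.diagonal_mul, Matrix.mul_diagonal, shiftMatrix]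
    split_ifs with hij hN
    · simp only [← hij, Nat.cast_succ, one_mul, mul_one, ← C_add, hsum]
    · have hsumN := hsum N
      rw [hI, hV] at hsumN
      have hi : (i : ℤ) + 1 = N := mod_cast hN.1
      rw [hi, hN.2, Nat.cast_zero, zero_add, mul_comm X, mul_comm X, ← add_mul, ← add_mul,
        ← C_add, ← C_add, hsumN]
    · simp
  simp only [bidiagonal, add_mul, mul_add, Matrix.diagonal_mul_diagonal, ← C_mul, h.V_mul_I]
  rw [add_assoc, add_assoc, add_right_inj, ← add_assoc, ← add_assoc, add_left_inj,
    add_comm, hshift, add_comm]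

theorem IsSolution.spectralPoly_eq (h : IsSolution M K N I V) (hM : 0 < M) (hK : 0 < K)
    (hMK : M.Coprime K) (s t : ℤ) : spectralPoly M K N I V s = spectralPoly M K N I V t :=
  charpoly_laxWord_eq hM hK hMK h.bidiagonal_mul s t

end Isospectrality

section ConservedProducts

theorem exists_eq_mul_sub_one {G : Type*} [CommGroup G] (f : ℤ → G) :
    ∃ H : ℤ → G, ∀ q, H q = f q * H (q - 1) := by
  refine ⟨fun q => (∏ j ∈ Finset.Ioc 0 q, f j) / ∏ j ∈ Finset.Ioc q 0, f j, fun q => ?_⟩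
  dsimp only
  rcases lt_or_ge 0 q with hq | hq
  · rw [← Finset.insert_Ioc_sub_one_right_eq_Ioc hq, Finset.prod_insert (by simp),
      Finset.Ioc_eq_empty_of_le hq.le, Finset.Ioc_eq_empty_of_le (Int.le_sub_one_of_lt hq),
      mul_div_assoc]
  · rw [← Finset.insert_Ioc_left_eq_Ioc_sub_one hq, Finset.prod_insert (by simp),
      Finset.Ioc_eq_empty_of_le hq,
      Finset.Ioc_eq_empty_of_le (b := q - 1) (by omega), Finset.prod_empty,
      ← mul_div_assoc, mul_one, div_mul_cancel_left, one_div]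

theorem exists_eq_mul_sub {G : Type*} [CommGroup G] (f : ℤ → G) {K : ℕ} (hK : 0 < K) :
    ∃ h : ℤ → G, ∀ t, h t = f t * h (t - K) := by
  choose H hH using fun r : ℤ => exists_eq_mul_sub_one fun q => f (r + K * q)
  refine ⟨fun t => H (t % K) (t / K), fun t => ?_⟩
  have hK' : (K : ℤ) ≠ 0 := mod_cast hK.ne'
  dsimp only
  rw [hH, Int.emod_add_mul_ediv, Int.sub_emod_right, Int.sub_ediv_of_dvd _ dvd_rfl,
    Int.ediv_self hK']

theorem prod_range_eq_prod_zmod {G : Type*} [CommMonoid G] {K : ℕ} [NeZero K] {u : ℤ → G}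
    (hu : Function.Periodic u K) {c : ℕ} (hc : c.Coprime K) (t : ℤ) :
    ∏ j ∈ Finset.range K, u (t - j * c) = ∏ z : ZMod K, u z.cast := by
  have hcast (n : ℤ) : u n = u (n : ZMod K).cast := by
    rw [ZMod.coe_intCast, Int.emod_def, mul_comm]
    exact (hu.sub_int_mul_eq (n / K)).symm
  have hinj : Function.Injective fun z : ZMod K => (t - z * c : ZMod K) := fun z w hzw =>
    ((ZMod.isUnit_iff_coprime c K).2 hc).mul_left_injective (sub_right_injective hzw)
  rw [← Function.Bijective.prod_comp (Finite.injective_iff_bijective.1 hinj)]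
  refine Finset.prod_nbij' (fun j : ℕ => (j : ZMod K)) ZMod.val (by simp)
    (fun z _ => Finset.mem_range.2 z.val_lt) (fun j hj => ?_) (by simp) fun j _ => ?_
  · exact ZMod.val_cast_of_lt (Finset.mem_range.1 hj)
  · rw [hcast]
    push_cast
    rfl

theorem prod_mul_prod_eq_of_commutation {G : Type*} [CommMonoid G] {M K : ℕ} (hK : 0 < K)
    (hMK : M.Coprime K) {v : ℤ → G} {i : ℤ → Gˣ} (h : ∀ t, v t * i t = i (t - M) * v (t - K))
    (s t : ℤ) :
    (∏ j ∈ Finset.range K, v (t - j * M)) * ∏ j ∈ Finset.range M, (i (t - j * K) : G) =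
      (∏ j ∈ Finset.range K, v (s - j)) * ∏ j ∈ Finset.range M, (i (s - j) : G) := by
  have : NeZero K := ⟨hK.ne'⟩
  -- With `i t = g t / g (t - K)`, the commutation says that `v t * g t / g (t - M)` has period `K`.
  obtain ⟨g, hg⟩ := exists_eq_mul_sub i hK
  have hi (t : ℤ) : i t = g t / g (t - K) := eq_div_of_mul_eq' (hg t).symm
  set u : ℤ → G := fun t => v t * ↑(g t / g (t - M)) with hu
  have hv (t : ℤ) : v t = u t * ↑(g (t - M) / g t) := by
    rw [hu, mul_assoc, ← Units.val_mul, div_mul_div_cancel, div_self', Units.val_one, mul_one]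
  have hper : Function.Periodic u K := fun t => by
    have ht := h (t + K)
    have hsub : t + K - M - K = t - M := by ring
    rw [hv, hv (t + K - K), hi, hi, hsub, add_sub_cancel_right, mul_left_comm, mul_assoc,
      ← Units.val_mul, ← Units.val_mul, div_mul_div_cancel, div_mul_div_cancel] at ht
    exact (Units.mul_left_inj _).1 ht
  calc _ = ∏ z : ZMod K, u z.cast := by
        have hv' := Finset.prod_range_div (fun j : ℕ => g (t - j * M)) K
        have hi' := Finset.prod_range_div' (fun j : ℕ => g (t - j * K)) M
        simp only [Nat.cast_succ, add_one_mul, Nat.cast_zero, zero_mul, sub_zero,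
          ← sub_sub] at hv' hi'
        simp only [hv, hi, Finset.prod_mul_distrib, ← Units.coe_prod]
        rw [hv', hi', mul_assoc, ← Units.val_mul, mul_comm (M : ℤ), div_mul_div_cancel,
          div_self', Units.val_one, mul_one, prod_range_eq_prod_zmod hper hMK t]
    _ = _ := by
        have hgK := Finset.prod_range_add (fun j : ℕ => g (s - j)) K M
        have hgM := Finset.prod_range_add (fun j : ℕ => g (s - j)) M K
        rw [add_comm, hgK] at hgM
        simp only [Nat.cast_add, ← sub_sub, sub_right_comm _ (M : ℤ),
          sub_right_comm _ (K : ℤ)] at hgM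
        simp only [hv, hi, Finset.prod_mul_distrib, ← Units.coe_prod, Finset.prod_div_distrib]
        rw [mul_assoc, ← Units.val_mul, div_mul_div_comm,
          mul_comm (∏ j ∈ Finset.range K, g (s - j - M)), ← hgM, div_self', Units.val_one, mul_one]
        simpa using (prod_range_eq_prod_zmod hper (Nat.coprime_one_left K) s).symm

end ConservedProducts

section LaxDiagonals

variable {M K N : ℕ} {I V : ℤ → ℤ → ℂ}

/-- The diagonals of the factors of the Lax matrix, in order. -/
def laxDiagonals (M K N : ℕ) (I V : ℤ → ℤ → ℂ) (t : ℤ) : List (Fin N → ℂ) :=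
  ((List.range K).reverse.map fun (j : ℕ) (i : Fin N) => V (i + 1) (t - j * M)) ++
    (List.range M).map fun (j : ℕ) (i : Fin N) => I (i + 1) (t - j * K)

theorem length_laxDiagonals (t : ℤ) : (laxDiagonals M K N I V t).length = M + K := by
  simp [laxDiagonals, add_comm]

theorem laxMatrix_eq_cyclicProd (t : ℤ) : laxMatrix M K N I V t =
    cyclicProd ((laxDiagonals M K N I V t).map (C ∘ ·)) X := by
  simp only [laxMatrix, cyclicProd, laxDiagonals, List.map_append, List.prod_append, List.map_map]
  rfl

theorem IsSolution.prod_laxDiagonals (h : IsSolution M K N I V) (hK : 0 < K) (hMK : M.Coprime K)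
    (t s : ℤ) (i : Fin N) :
    ((laxDiagonals M K N I V t).map (· i)).prod =
      (∏ k ∈ Finset.Icc 1 K, V (i + 1) (s - (k : ℕ))) *
        ∏ k ∈ Finset.Icc 1 M, I (i + 1) (s - (k : ℕ)) := by
  have hIcc (n : ℕ) (f : ℤ → ℂ) :
      ∏ k ∈ Finset.Icc 1 n, f (s - (k : ℕ)) = ∏ j ∈ Finset.range n, f (s - 1 - j) := by
    rw [← Finset.Ico_add_one_right_eq_Icc, Finset.prod_Ico_eq_prod_range]
    simp [sub_sub]
  rw [hIcc, hIcc]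
  have hprod := prod_mul_prod_eq_of_commutation hK hMK (v := V (i + 1))
    (i := fun t => Units.mk0 _ (h.I_ne_zero (i + 1) t)) (h.V_mul_I _) (s - 1) t
  simp only [Units.val_mk0] at hprod
  rw [← hprod, laxDiagonals, List.map_append, List.prod_append, List.map_map, List.map_map,
    List.map_reverse, List.prod_reverse]
  rfl

end LaxDiagonals

section CabCurves

variable {k : Type*} [Field k] {m N : ℕ} {F : k[X][X]}

/-- The polynomials `F(x, y) = x ^ N - y ^ m + ⋯`, where the dots stand for terms of lower weight if
`x` has weight `m` and `y` has weight `N`. For coprime `m` and `N`, the curve `F(x, y) = 0` (in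
coding theory, a `C_ab` curve) has a single place at infinity. As elsewhere, `x` is the outer
variable. -/
def IsCab (m N : ℕ) (F : k[X][X]) : Prop :=
  ∀ a b, ((F - (X ^ N - C (X ^ m))).coeff a).coeff b ≠ 0 → m * a + N * b < m * N

theorem aevalAeval_eq_sum {A : Type*} [CommRing A] [Algebra k A] (x y : A) (p : k[X][X]) :
    aevalAeval y x p = ∑ a ∈ p.support, ∑ b ∈ (p.coeff a).support,
      algebraMap k A ((p.coeff a).coeff b) * (y ^ b * x ^ a) := by
  conv_lhs => rw [p.as_sum_support, map_sum]
  refine Finset.sum_congr rfl fun a _ => ?_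
  rw [← C_mul_X_pow_eq_monomial, map_mul, map_pow, aevalAeval_C, aevalAeval_Y, aeval_def,
    eval₂_eq_sum, Polynomial.sum, Finset.sum_mul]
  simp only [mul_assoc]

namespace IsCab

theorem degree_sub_lt (h : IsCab m N F) : (F - (X ^ N - C (X ^ m))).degree < (N : WithBot ℕ) := by
  rw [degree_lt_iff_coeff_zero]
  intro a ha
  ext b
  by_contra hab
  have := h a b hab
  have := Nat.mul_le_mul_left m ha
  omega

theorem exists_eq_X_pow_add (h : IsCab m N F) (hN : 0 < N) :
    ∃ q : k[X][X], q.degree < (N : WithBot ℕ) ∧ F = X ^ N + q := by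
  refine ⟨F - (X ^ N - C (X ^ m)) - C (X ^ m), ?_, by ring⟩
  exact (degree_sub_le _ _).trans_lt
    (max_lt h.degree_sub_lt (degree_C_le.trans_lt (by exact_mod_cast hN)))

theorem monic (h : IsCab m N F) (hN : 0 < N) : F.Monic := by
  obtain ⟨q, hq, rfl⟩ := h.exists_eq_X_pow_add hN
  exact monic_X_pow_add hq

theorem natDegree_eq (h : IsCab m N F) (hN : 0 < N) : F.natDegree = N := by
  obtain ⟨q, hq, rfl⟩ := h.exists_eq_X_pow_add hN
  rw [natDegree_add_eq_left_of_degree_lt (by rwa [degree_X_pow]), natDegree_X_pow]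

end IsCab

section Valuation

variable {Γ₀ : Type*} [LinearOrderedCommGroupWithZero Γ₀] {L : Type*} [Field L] [Algebra k L]
  {v : Valuation L Γ₀} [v.IsTrivialOn k] {x y : L}

theorem val_aevalAeval_lt {μ : Γ₀} (hμ : μ ≠ 0) {p : k[X][X]}
    (h : ∀ a b, (p.coeff a).coeff b ≠ 0 → v y ^ b * v x ^ a < μ) : v (aevalAeval y x p) < μ := by
  rw [aevalAeval_eq_sum]
  refine v.map_sum_lt hμ fun a _ => v.map_sum_lt hμ fun b hb => ?_
  rw [map_mul, Valuation.IsTrivialOn.eq_one _ (mem_support_iff.1 hb), one_mul, map_mul, map_pow,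
    map_pow]
  exact h a b (mem_support_iff.1 hb)

theorem pow_mul_pow_lt_max {μ ν : Γ₀} (h : 1 < max (μ ^ N) (ν ^ m)) {a b : ℕ}
    (hab : m * a + N * b < m * N) : ν ^ b * μ ^ a < max (μ ^ N) (ν ^ m) := by
  refine lt_of_pow_lt_pow_left₀ (m * N) zero_le ?_
  calc (ν ^ b * μ ^ a) ^ (m * N) = (μ ^ N) ^ (m * a) * (ν ^ m) ^ (N * b) := by
        rw [mul_pow, ← pow_mul, ← pow_mul, ← pow_mul, ← pow_mul, mul_comm]
        congr 2 <;> ring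
    _ ≤ max (μ ^ N) (ν ^ m) ^ (m * a) * max (μ ^ N) (ν ^ m) ^ (N * b) :=
        mul_le_mul' (pow_le_pow_left' (le_max_left _ _) _) (pow_le_pow_left' (le_max_right _ _) _)
    _ = max (μ ^ N) (ν ^ m) ^ (m * a + N * b) := (pow_add _ _ _).symm
    _ < max (μ ^ N) (ν ^ m) ^ (m * N) := pow_lt_pow_right₀ h hab

theorem IsCab.val_pow_sub_pow_lt (h : IsCab m N F) (hF : aevalAeval y x F = 0)
    (hxy : 1 < max (v x ^ N) (v y ^ m)) : v (x ^ N - y ^ m) < max (v x ^ N) (v y ^ m) := by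
  have hG : aevalAeval y x (F - (X ^ N - C (X ^ m))) = -(x ^ N - y ^ m) := by
    rw [map_sub, hF, zero_sub, map_sub, map_pow, aevalAeval_C, aevalAeval_Y, map_pow, aeval_X]
  rw [← v.map_neg, ← hG]
  exact val_aevalAeval_lt (zero_lt_one.trans hxy).ne' fun a b hab =>
    pow_mul_pow_lt_max hxy (h a b hab)

theorem IsCab.val_pow_eq_val_pow (h : IsCab m N F) (hF : aevalAeval y x F = 0)
    (hxy : 1 < max (v x ^ N) (v y ^ m)) : v x ^ N = v y ^ m := by
  have hlt := h.val_pow_sub_pow_lt hF hxy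
  rw [← map_pow, ← map_pow] at hlt ⊢
  by_contra hne
  refine hlt.ne ?_
  rw [sub_eq_add_neg, v.map_add_of_distinct_val (by rwa [v.map_neg]), v.map_neg]

theorem IsCab.one_lt_val_iff (h : IsCab m N F) (hm : 0 < m) (hN : 0 < N)
    (hF : aevalAeval y x F = 0) : 1 < v x ↔ 1 < v y := by
  constructor <;> intro hlt
  · rw [← one_lt_pow_iff hm.ne',
      ← h.val_pow_eq_val_pow hF (lt_max_of_lt_left (one_lt_pow₀ hlt hN.ne'))]
    exact one_lt_pow₀ hlt hN.ne'
  · rw [← one_lt_pow_iff hN.ne',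
      h.val_pow_eq_val_pow hF (lt_max_of_lt_right (one_lt_pow₀ hlt hm.ne'))]
    exact one_lt_pow₀ hlt hm.ne'

end Valuation

theorem exists_eq_exp_of_pow_eq_pow (hN : 0 < N) (hmN : m.Coprime N) {μ ν : ℤᵐ⁰}
    (h : μ ^ N = ν ^ m) (hν : 1 < ν) :
    ∃ e : ℕ, 0 < e ∧ μ = WithZero.exp (m : ℤ) ^ e ∧ ν = WithZero.exp (N : ℤ) ^ e := by
  have hν0 : ν ≠ 0 := (zero_lt_one.trans hν).ne'
  have hμ0 : μ ≠ 0 := fun h0 => pow_ne_zero m hν0 (by rw [← h, h0, zero_pow hN.ne'])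
  obtain ⟨s, rfl⟩ : ∃ s, μ = WithZero.exp s := ⟨_, (WithZero.exp_log hμ0).symm⟩
  obtain ⟨t, rfl⟩ : ∃ t, ν = WithZero.exp t := ⟨_, (WithZero.exp_log hν0).symm⟩
  simp only [← WithZero.exp_nsmul, nsmul_eq_mul, WithZero.exp_inj] at h ⊢
  rw [← WithZero.exp_zero, WithZero.exp_lt_exp] at hν
  have hNz : (0 : ℤ) < N := by exact_mod_cast hN
  obtain ⟨e, rfl⟩ : (N : ℤ) ∣ t :=
    (Nat.isCoprime_iff_coprime.2 hmN.symm).dvd_of_dvd_mul_left ⟨_, h.symm⟩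
  lift e to ℕ using (pos_of_mul_pos_right hν hNz.le).le
  refine ⟨e, ?_, ?_, mul_comm _ _⟩
  · exact_mod_cast pos_of_mul_pos_right hν hNz.le
  · exact mul_left_cancel₀ hNz.ne' (by rw [h]; ring)

/-- The weighted degree of `p(x, y)`, if `x` has weight `m` and `y` has weight `N`. -/
def weightedDegree (m N : ℕ) (p : k[X][X]) : ℕ :=
  p.support.sup fun a => m * a + N * (p.coeff a).natDegree

theorem eq_of_weight_eq (hmN : m.Coprime N) {a a' b b' : ℕ} (ha : a < N) (ha' : a' < N)
    (h : m * a + N * b = m * a' + N * b') : a = a' := by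
  have hmod : m * a ≡ m * a' [MOD N] := by
    simpa only [Nat.ModEq, Nat.add_mul_mod_self_left] using congrArg (· % N) h
  exact (Nat.ModEq.cancel_left_of_coprime hmN.symm hmod).eq_of_lt_of_lt ha ha'

variable {L : Type*} [Field L] [Algebra k L] {v : Valuation L ℤᵐ⁰} [v.IsTrivialOn k] {x y : L}

theorem val_aevalAeval_eq_exp_weightedDegree (hmN : m.Coprime N) {e : ℕ} (he : 0 < e)
    (hx : v x = WithZero.exp (m : ℤ) ^ e) (hy : v y = WithZero.exp (N : ℤ) ^ e) {p : k[X][X]}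
    (hp : p ≠ 0) (hpN : p.natDegree < N) :
    v (aevalAeval y x p) = WithZero.exp (weightedDegree m N p : ℤ) ^ e := by
  have hy1 : 1 < v y := by
    rw [hy, ← WithZero.exp_zero, ← WithZero.exp_nsmul, WithZero.exp_lt_exp, nsmul_eq_mul]
    exact_mod_cast Nat.mul_pos he (by omega : 0 < N)
  have hterm {a : ℕ} (ha : a ∈ p.support) : v (aeval y (p.coeff a) * x ^ a) =
      WithZero.exp ((m * a + N * (p.coeff a).natDegree : ℕ) : ℤ) ^ e := by
    rw [map_mul, map_pow, valuation_aeval_eq_valuation_X_pow_natDegree_of_one_lt_valuation_X y hy1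
      (mem_support_iff.1 ha), hx, hy]
    simp only [← WithZero.exp_nsmul, ← WithZero.exp_add, nsmul_eq_mul]
    push_cast
    ring_nf
  obtain ⟨a₀, ha₀, hmax⟩ := Finset.exists_mem_eq_sup p.support (support_nonempty.2 hp)
    fun a => m * a + N * (p.coeff a).natDegree
  have hsum : aevalAeval y x p = ∑ a ∈ p.support, aeval y (p.coeff a) * x ^ a := by
    conv_lhs => rw [p.as_sum_support_C_mul_X_pow, map_sum]
    simp only [map_mul, map_pow, aevalAeval_C, aevalAeval_Y]
  rw [hsum, weightedDegree, hmax, ← hterm ha₀]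
  refine v.map_sum_eq_of_lt ha₀ fun a ha => ?_
  obtain ⟨ha, hne⟩ := Finset.mem_sdiff.1 ha
  rw [hterm ha, hterm ha₀]
  refine pow_lt_pow_left₀ (WithZero.exp_lt_exp.2 (Nat.cast_lt.2 (lt_of_le_of_ne ?_ fun heq => ?_)))
    zero_le he.ne'
  · exact hmax ▸ Finset.le_sup (f := fun a => m * a + N * (p.coeff a).natDegree) ha
  · exact hne (Finset.mem_singleton.2 (eq_of_weight_eq hmN
      ((le_natDegree_of_mem_supp a ha).trans_lt hpN)
      ((le_natDegree_of_mem_supp a₀ ha₀).trans_lt hpN)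
      heq))

theorem IsCab.val_aevalAeval_eq (h : IsCab m N F) (hN : 0 < N) (hmN : m.Coprime N)
    (hF : aevalAeval y x F = 0) {e : ℕ} (he : 0 < e) (hx : v x = WithZero.exp (m : ℤ) ^ e)
    (hy : v y = WithZero.exp (N : ℤ) ^ e) {p : k[X][X]} (hp : ¬ F ∣ p) :
    v (aevalAeval y x p) = WithZero.exp (weightedDegree m N (p %ₘ F) : ℤ) ^ e := by
  have hmod : aevalAeval y x (p %ₘ F) = aevalAeval y x p := by
    rw [modByMonic_eq_sub_mul_div p, map_sub, map_mul, hF, zero_mul, sub_zero]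
  rw [← hmod]
  refine val_aevalAeval_eq_exp_weightedDegree hmN he hx hy
    (mt (modByMonic_eq_zero_iff_dvd (h.monic hN)).1 hp) ?_
  exact (natDegree_modByMonic_lt p (h.monic hN)
    (ne_of_apply_ne natDegree (by rw [h.natDegree_eq hN, natDegree_one]; exact hN.ne'))).trans_eq
    (h.natDegree_eq hN)

end CabCurves

section PowerSeriesRoots

variable {k : Type*} [Field k]

theorem aevalAeval_eq_eval₂ {A : Type*} [CommRing A] [Algebra k A] (x y : A) (p : k[X][X]) :
    aevalAeval y x p = p.eval₂ (aeval y : k[X] →ₐ[k] A).toRingHom x := by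
  induction p using Polynomial.induction_on' with
  | add p q hp hq => rw [map_add, eval₂_add, hp, hq]
  | monomial n c => simp [← C_mul_X_pow_eq_monomial]

theorem map_aevalAeval {A B : Type*} [CommRing A] [Algebra k A] [CommRing B] [Algebra k B]
    (f : A →ₐ[k] B) (x y : A) (p : k[X][X]) :
    f (aevalAeval y x p) = aevalAeval (f y) (f x) p := by
  simp only [aevalAeval_eq_sum, map_sum, map_mul, map_pow, AlgHom.commutes]

theorem exists_powerSeries_root {Φ : k[X][X]} (hΦ : Φ.Monic) {a b : k} (h0 : Φ.evalEval b a = 0)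
    (h1 : (derivative (Φ.map (evalRingHom b))).eval a ≠ 0) :
    ∃ ξ : PowerSeries k, PowerSeries.constantCoeff ξ = a ∧
      aevalAeval (PowerSeries.C b + PowerSeries.X) ξ Φ = 0 := by
  set θ : k[X] →+* PowerSeries k := (aeval (PowerSeries.C b + PowerSeries.X) :
    k[X] →ₐ[k] PowerSeries k).toRingHom with hθ
  have hmap : (Φ.map θ).map PowerSeries.constantCoeff = Φ.map (evalRingHom b) := by
    rw [Polynomial.map_map]
    congr 1
    ext <;> simp [hθ, PowerSeries.algebraMap_eq]
  have ha : a = PowerSeries.constantCoeff (PowerSeries.C a) := by simp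
  rw [← map_evalRingHom_eval, ← hmap, ha, eval_map_apply] at h0
  rw [← hmap, ha, derivative_map, eval_map_apply] at h1
  obtain ⟨ξ, hroot, hξ⟩ := HenselianRing.is_henselian (I := Ideal.span {PowerSeries.X}) (Φ.map θ)
    (hΦ.map θ) (PowerSeries.C a) (Ideal.mem_span_singleton.2 (PowerSeries.X_dvd_iff.2 h0))
    ((PowerSeries.isUnit_iff_constantCoeff.2 (isUnit_iff_ne_zero.2 h1)).map _)
  rw [Ideal.mem_span_singleton, PowerSeries.X_dvd_iff, map_sub, ← ha, sub_eq_zero] at hξ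
  exact ⟨ξ, hξ, by rw [aevalAeval_eq_eval₂, ← hroot.eq_zero, eval_map]⟩

/-- The inclusion of the power series in the Laurent series. -/
def powerSeriesToLaurent (k : Type*) [Field k] : PowerSeries k →ₐ[k] LaurentSeries k :=
  ⟨HahnSeries.ofPowerSeries ℤ k, fun _ => rfl⟩

theorem powerSeriesToLaurent_X :
    powerSeriesToLaurent k PowerSeries.X = HahnSeries.single (1 : ℤ) 1 :=
  PowerSeries.coe_X

theorem val_powerSeriesToLaurent_lt_one_iff {f : PowerSeries k} :
    Valued.v (powerSeriesToLaurent k f) < 1 ↔ PowerSeries.constantCoeff f = 0 := by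
  rw [LaurentSeries.valuation_def, ← PowerSeries.X_dvd_iff, ← Ideal.mem_span_singleton]
  exact IsDedekindDomain.HeightOneSpectrum.valuation_lt_one_iff_mem _ f

theorem val_powerSeriesToLaurent_eq_one {f : PowerSeries k}
    (hf : PowerSeries.constantCoeff f ≠ 0) : Valued.v (powerSeriesToLaurent k f) = 1 :=
  ((LaurentSeries.val_le_one_iff_eq_coe k _).2 ⟨f, rfl⟩).eq_of_not_lt
    (mt val_powerSeriesToLaurent_lt_one_iff.1 hf)

instance isTrivialOn_laurentSeries :
    (Valued.v : Valuation (LaurentSeries k) ℤᵐ⁰).IsTrivialOn k where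
  eq_one c hc := by
    rw [← (powerSeriesToLaurent k).commutes]
    exact val_powerSeriesToLaurent_eq_one (by simpa [PowerSeries.algebraMap_eq] using hc)

end PowerSeriesRoots

section WeightReversal

variable {k : Type*} [Field k] {m N : ℕ} {F : k[X][X]}

/-- The polynomial `H` with `s ^ d * G(x / s ^ m, 1 / s ^ N) = H(x, s)`, provided that all terms of
`G` have weight at most `d` if `x` has weight `m` and `y` has weight `N`. -/
def weightReversal (m N d : ℕ) (G : k[X][X]) : k[X][X] :=
  ∑ a ∈ G.support, C (∑ b ∈ (G.coeff a).support,
    C ((G.coeff a).coeff b) * X ^ (d - (m * a + N * b))) * X ^ a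

theorem aevalAeval_weightReversal {A : Type*} [CommRing A] [Algebra k A] {s z : A} (h : s * z = 1)
    {d : ℕ} {G : k[X][X]} (hG : ∀ a b, (G.coeff a).coeff b ≠ 0 → m * a + N * b ≤ d) (x : A) :
    aevalAeval (z ^ N) (z ^ m * x) G = z ^ d * aevalAeval s x (weightReversal m N d G) := by
  simp only [weightReversal, aevalAeval_eq_sum _ _ G, map_sum, map_mul, map_pow, aevalAeval_C,
    aevalAeval_Y, aeval_C, aeval_X, Finset.mul_sum, Finset.sum_mul]
  refine Finset.sum_congr rfl fun a _ => Finset.sum_congr rfl fun b hb => ?_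
  have hsz : z ^ d * s ^ (d - (m * a + N * b)) = z ^ (m * a + N * b) := by
    obtain ⟨c, rfl⟩ := Nat.exists_eq_add_of_le (hG a b (mem_support_iff.1 hb))
    rw [Nat.add_sub_cancel_left, pow_add, mul_assoc, ← mul_pow, mul_comm z, h, one_pow, mul_one]
  linear_combination (-algebraMap k A ((G.coeff a).coeff b) * x ^ a) * hsz

theorem degree_weightReversal_lt {d n : ℕ} {G : k[X][X]} (hG : G.degree < n) :
    (weightReversal m N d G).degree < n := by
  refine (degree_sum_le _ _).trans_lt ((Finset.sup_lt_iff (WithBot.bot_lt_coe n)).2 fun a ha => ?_)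
  refine (degree_C_mul_X_pow_le _ _).trans_lt ((le_degree_of_mem_supp a ha).trans_lt hG)

theorem map_eval_zero_weightReversal {d : ℕ} {G : k[X][X]}
    (hG : ∀ a b, (G.coeff a).coeff b ≠ 0 → m * a + N * b < d) :
    (weightReversal m N d G).map (evalRingHom 0) = 0 := by
  rw [weightReversal, Polynomial.map_sum]
  refine Finset.sum_eq_zero fun a _ => ?_
  rw [Polynomial.map_mul, map_C, map_sum, Finset.sum_eq_zero, C_0, zero_mul]
  intro b hb
  rw [coe_evalRingHom, eval_mul, eval_pow, eval_X, zero_pow, mul_zero]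
  exact (Nat.sub_pos_of_lt (hG a b (mem_support_iff.1 hb))).ne'

theorem IsCab.exists_weightReversal (h : IsCab m N F) (hN : 0 < N) :
    ∃ Φ : k[X][X], Φ.Monic ∧ Φ.map (evalRingHom 0) = X ^ N - 1 ∧
      ∀ {A : Type*} [CommRing A] [Algebra k A] {s z : A}, s * z = 1 → ∀ x : A,
        aevalAeval (z ^ N) (z ^ m * x) F = z ^ (m * N) * aevalAeval s x Φ := by
  obtain ⟨G, hG⟩ : ∃ G, G = F - (X ^ N - C (X ^ m)) := ⟨_, rfl⟩
  have hwt : ∀ a b, (G.coeff a).coeff b ≠ 0 → m * a + N * b < m * N := by rwa [hG]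
  refine ⟨X ^ N + (weightReversal m N (m * N) G - 1), monic_X_pow_add ?_, ?_, ?_⟩
  · exact (degree_sub_le _ _).trans_lt (max_lt
      (degree_weightReversal_lt (hG ▸ h.degree_sub_lt))
      (degree_one_le.trans_lt (by exact_mod_cast hN)))
  · rw [Polynomial.map_add, Polynomial.map_sub, map_eval_zero_weightReversal hwt,
      Polynomial.map_pow, map_X, Polynomial.map_one, zero_sub, sub_eq_add_neg]
  · intro A _ _ s z hsz x
    rw [← add_eq_of_eq_sub hG, add_comm, map_add,
      aevalAeval_weightReversal hsz fun a b hab => (hwt a b hab).le]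
    simp only [map_sub, map_add, map_pow, map_one, aevalAeval_C, aevalAeval_Y, aeval_X]
    ring

theorem IsCab.exists_laurentSeries (h : IsCab m N F) (hN : 0 < N) (hNk : (N : k) ≠ 0) :
    ∃ x y : LaurentSeries k, aevalAeval y x F = 0 ∧ Valued.v x = WithZero.exp (m : ℤ) ∧
      Valued.v y = WithZero.exp (N : ℤ) := by
  obtain ⟨Φ, hΦ, hmap, hrev⟩ := h.exists_weightReversal hN
  obtain ⟨ξ, hξ1, hξ⟩ := exists_powerSeries_root hΦ (a := 1) (b := 0)
    (by rw [← map_evalRingHom_eval, hmap]; simp)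
    (by rw [hmap, derivative_sub, derivative_X_pow]; simpa using hNk)
  set ι := powerSeriesToLaurent k with hι
  set z : LaurentSeries k := HahnSeries.single (-1) 1 with hz
  have hιz : ι PowerSeries.X * z = 1 := by
    rw [hι, powerSeriesToLaurent_X, hz, HahnSeries.single_mul_single]
    simp
  have hzpow (n : ℕ) : Valued.v (z ^ n) = WithZero.exp (n : ℤ) := by
    rw [hz, HahnSeries.single_pow, one_pow, LaurentSeries.valuation_single_zpow]
    simp
  refine ⟨z ^ m * ι ξ, z ^ N, ?_, ?_, hzpow N⟩
  · rw [map_zero, zero_add] at hξ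
    rw [hrev hιz, ← map_aevalAeval, hξ, map_zero, mul_zero]
  · rw [map_mul, hzpow, val_powerSeriesToLaurent_eq_one (by rw [hξ1]; exact one_ne_zero), mul_one]

end WeightReversal

section CyclicCurve

variable {k : Type*} [Field k] {N : ℕ}

/-- The curve `det (x E - ∏ (diag(d) + S(y))) = 0`, where `d` runs through the list `ds`. -/
def cyclicCurve (ds : List (Fin N → k)) : k[X][X] :=
  (cyclicProd (ds.map (C ∘ ·)) X).charpoly

/-- The curve `cyclicCurve ds` in the coordinates `x * s ^ m`, `s` for `s ^ N * y = 1`, where `m` is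
the length of `ds`. -/
def cyclicCurveAtInfty (ds : List (Fin N → k)) : k[X][X] :=
  (cyclicProd (ds.map fun d i => X * C (d i)) 1).charpoly

theorem natDegree_cyclicCurve (ds : List (Fin N → k)) : (cyclicCurve ds).natDegree = N := by
  rw [cyclicCurve, Matrix.charpoly_natDegree_eq_dim, Fintype.card_fin]

theorem toLaurent_expand_coeff_cyclicCurve (ds : List (Fin N → k)) {a : ℕ} (ha : a ≤ N) :
    toLaurent (expand k N ((cyclicCurve ds).coeff a)) =
      LaurentPolynomial.T (ds.length * (N - a) : ℕ) *
        LaurentPolynomial.invert (toLaurent ((cyclicCurveAtInfty ds).coeff a)) := by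
  set κ : LaurentPolynomial k := LaurentPolynomial.T (-1)
  set z : LaurentPolynomial k := LaurentPolynomial.T 1
  have h : κ * z = 1 := by rw [← LaurentPolynomial.T_add]; rfl
  have hy : z ^ N * κ ^ N = 1 := by rw [← mul_pow, mul_comm, h, one_pow]
  let f : k[X] →+* LaurentPolynomial k := toLaurent.comp (expand k N : k[X] →+* k[X])
  let g : k[X] →+* LaurentPolynomial k :=
    (LaurentPolynomial.invert (R := k) : LaurentPolynomial k →+* LaurentPolynomial k).comp toLaurent
  have hf : (cyclicCurve ds).map f =
      (cyclicProd (ds.map (LaurentPolynomial.C ∘ ·)) (z ^ N)).charpoly := by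
    rw [cyclicCurve, charpoly_cyclicProd_map, List.map_map]
    congr 3
    · ext d i
      simp [f]
    · simp [f, z]
  have hg : (cyclicCurveAtInfty ds).map g =
      (cyclicProd ((ds.map (LaurentPolynomial.C ∘ ·)).map (κ • ·)) 1).charpoly := by
    rw [cyclicCurveAtInfty, charpoly_cyclicProd_map, List.map_map, List.map_map]
    congr 3
    · ext d i
      simp [g, κ]
    · exact map_one g
  calc toLaurent (expand k N ((cyclicCurve ds).coeff a)) = ((cyclicCurve ds).map f).coeff a := by
        rw [coeff_map]; rfl
    _ = z ^ (ds.length * (N - a)) * ((cyclicCurveAtInfty ds).map g).coeff a := by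
        rw [hf, hg, charpoly_cyclicProd_coeff h _ _ ha, hy, List.length_map]
    _ = _ := by
        rw [LaurentPolynomial.T_pow, mul_one, coeff_map]
        rfl

theorem coeff_toLaurent (p : k[X]) (n : ℤ) :
    (toLaurent p).coeff n = if 0 ≤ n then p.coeff n.toNat else 0 := by
  rw [LaurentPolynomial.coeff_toLaurent]
  split_ifs with hn
  · conv_lhs => rw [← Int.toNat_of_nonneg hn]
    exact Finsupp.mapDomain_apply Nat.cast_injective _ _
  · refine Finsupp.mapDomain_of_notMem_range _ _ ?_
    rintro ⟨i, rfl⟩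
    exact hn (Int.natCast_nonneg i)

theorem coeff_coeff_cyclicCurve (ds : List (Fin N → k)) (hN : 0 < N) {a b : ℕ} (ha : a ≤ N) :
    ((cyclicCurve ds).coeff a).coeff b =
      if N * b ≤ ds.length * (N - a) then
        ((cyclicCurveAtInfty ds).coeff a).coeff (ds.length * (N - a) - N * b) else 0 := by
  have h := congrArg (fun p : LaurentPolynomial k => p.coeff ((b * N : ℕ) : ℤ))
    (toLaurent_expand_coeff_cyclicCurve ds ha)
  simp only [LaurentPolynomial.T, AddMonoidAlgebra.coeff_single_mul_apply, one_mul, coeff_toLaurent,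
    LaurentPolynomial.invert_apply, Int.natCast_nonneg, if_true, Int.toNat_natCast,
    coeff_expand_mul hN] at h
  rw [h, mul_comm b]
  refine if_congr (by omega) (congrArg _ (by omega)) rfl

theorem map_eval_zero_cyclicCurveAtInfty [NeZero N] (ds : List (Fin N → k))
    (hm : ds.length.Coprime N) : (cyclicCurveAtInfty ds).map (evalRingHom 0) = X ^ N - 1 := by
  rw [cyclicCurveAtInfty, charpoly_cyclicProd_map, cyclicProd_eq_pow, List.length_map,
    List.length_map, map_one, charpoly_cyclicBidiagonal_zero_one_pow hm]
  simp only [List.mem_map]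
  rintro _ ⟨_, ⟨d, -, rfl⟩, rfl⟩
  ext i
  simp

theorem coeff_coeff_zero_cyclicCurveAtInfty [NeZero N] (ds : List (Fin N → k))
    (hm : ds.length.Coprime N) (a : ℕ) :
    ((cyclicCurveAtInfty ds).coeff a).coeff 0 =
      (if a = N then 1 else 0) - if a = 0 then 1 else 0 := by
  have h := congrArg (coeff · a) (map_eval_zero_cyclicCurveAtInfty ds hm)
  rwa [coeff_map, coe_evalRingHom, ← coeff_zero_eq_eval_zero, coeff_sub, coeff_X_pow,
    coeff_one] at h

theorem coeff_coeff_X_pow_sub_C_X_pow (m N a b : ℕ) :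
    ((X ^ N - C (X ^ m) : k[X][X]).coeff a).coeff b =
      (if a = N ∧ b = 0 then 1 else 0) - if a = 0 ∧ b = m then 1 else 0 := by
  rw [coeff_sub, coeff_X_pow, coeff_C]
  split_ifs <;> simp_all [coeff_X_pow, coeff_one]

theorem isCab_cyclicCurve [NeZero N] (ds : List (Fin N → k)) (hm : ds.length.Coprime N) :
    IsCab ds.length N (cyclicCurve ds) := by
  intro a b hab
  have hN := NeZero.pos N
  by_contra! hle
  refine hab ?_
  rw [coeff_sub, coeff_sub, coeff_coeff_X_pow_sub_C_X_pow]
  rcases lt_or_ge N a with ha | ha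
  · rw [coeff_eq_zero_of_natDegree_lt (p := cyclicCurve ds) (by rwa [natDegree_cyclicCurve]),
      coeff_zero, if_neg (by omega), if_neg (by omega), sub_zero, sub_zero]
  have hsplit : ds.length * N = ds.length * a + ds.length * (N - a) := by
    rw [← mul_add, Nat.add_sub_cancel' ha]
  rw [coeff_coeff_cyclicCurve ds hN ha]
  rcases (show ds.length * (N - a) ≤ N * b by omega).lt_or_eq with hlt | heq
  · rw [if_neg hlt.not_ge, if_neg, if_neg, sub_zero, sub_zero]
    · rintro ⟨rfl, rfl⟩
      rw [Nat.sub_zero, mul_comm] at hlt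
      exact hlt.false
    · rintro ⟨rfl, rfl⟩
      exact absurd hlt (Nat.not_lt_zero _)
  · have hb : a = N → b = 0 := by
      rintro rfl
      simpa [hN.ne'] using heq.symm
    have hbm : a = 0 → b = ds.length := by
      rintro rfl
      exact (Nat.eq_of_mul_eq_mul_left hN (by rw [← heq, mul_comm, Nat.sub_zero])).symm
    rw [if_pos heq.ge, heq, Nat.sub_self, coeff_coeff_zero_cyclicCurveAtInfty ds hm]
    simp only [and_iff_left_of_imp hb, and_iff_left_of_imp hbm, sub_self]

end CyclicCurve

section GenericPoints

variable {k : Type*} [Field k] {L : Type*} [Field L] [Algebra k L] {m N : ℕ} {F : k[X][X]}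
  {x y : L}

/-- `(x, y)`, with coordinates in an extension field, is a generic point of the plane curve
`F(x, y) = 0`: only the multiples of `F` vanish there. -/
def IsGenericPoint (F : k[X][X]) (x y : L) : Prop := ∀ p : k[X][X], aevalAeval y x p = 0 ↔ F ∣ p

theorem IsCab.isGenericPoint (h : IsCab m N F) (hN : 0 < N) (hmN : m.Coprime N)
    {v : Valuation L ℤᵐ⁰} [v.IsTrivialOn k] (hF : aevalAeval y x F = 0)
    (hx : v x = WithZero.exp (m : ℤ)) (hy : v y = WithZero.exp (N : ℤ)) : IsGenericPoint F x y := by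
  refine fun p => ⟨fun hp => ?_, ?_⟩
  · by_contra hdvd
    have := h.val_aevalAeval_eq hN hmN hF one_pos (by rwa [pow_one]) (by rwa [pow_one]) hdvd
    rw [hp, map_zero] at this
    exact pow_ne_zero _ WithZero.exp_ne_zero this.symm
  · rintro ⟨q, rfl⟩
    rw [map_mul, hF, zero_mul]

/-- Evaluation of the regular functions of the plane curve `F = 0` at a point of the curve. -/
def evalAt (hF : aevalAeval y x F = 0) : AdjoinRoot F →ₐ[k] L :=
  AdjoinRoot.liftAlgHom F (aeval y) x (by rwa [aevalAeval_eq_eval₂] at hF)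

theorem evalAt_mk (hF : aevalAeval y x F = 0) (p : k[X][X]) :
    evalAt hF (AdjoinRoot.mk F p) = aevalAeval y x p := by
  rw [aevalAeval_eq_eval₂]
  rfl

theorem injective_evalAt_iff (hF : aevalAeval y x F = 0) :
    Function.Injective (evalAt hF) ↔ IsGenericPoint F x y := by
  rw [injective_iff_map_eq_zero, AdjoinRoot.mk_surjective.forall]
  simp only [evalAt_mk, AdjoinRoot.mk_eq_zero]
  exact forall_congr' fun p =>
    ⟨fun h => ⟨h, fun ⟨q, hq⟩ => by rw [hq, map_mul, hF, zero_mul]⟩, Iff.mp⟩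

namespace IsGenericPoint

theorem aevalAeval_self (h : IsGenericPoint F x y) : aevalAeval y x F = 0 := (h F).2 dvd_rfl

theorem isDomain (h : IsGenericPoint F x y) : IsDomain (AdjoinRoot F) :=
  ((injective_evalAt_iff h.aevalAeval_self).2 h).isDomain (evalAt _)

end IsGenericPoint

theorem IsCab.isDomain (h : IsCab m N F) (hN : 0 < N) (hNk : (N : k) ≠ 0) (hmN : m.Coprime N) :
    IsDomain (AdjoinRoot F) := by
  obtain ⟨x, y, hF, hx, hy⟩ := h.exists_laurentSeries hN hNk
  exact (h.isGenericPoint hN hmN hF hx hy).isDomain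

end GenericPoints

section RationalFunctions

variable {F : ℂ[X][X]}

theorem aevalAeval_yFun_xFun (p : ℂ[X][X]) :
    aevalAeval (yFun F) (xFun F) p = algebraMap (AdjoinRoot F) (RatFun F) (AdjoinRoot.mk F p) := by
  have : aevalAeval (yFun F) (xFun F) = ((IsScalarTower.toAlgHom ℂ (AdjoinRoot F) (RatFun F)).comp
      (AdjoinRoot.mkₐ F |>.restrictScalars ℂ)) := by
    ext <;> simp [xFun, yFun]
  rw [this]
  rfl

theorem aevalAeval_yFun_xFun_self : aevalAeval (yFun F) (xFun F) F = 0 := by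
  rw [aevalAeval_yFun_xFun, AdjoinRoot.mk_self, map_zero]

theorem IsGenericPoint.exists_algHom {L : Type*} [Field L] [Algebra ℂ L] {x y : L}
    (h : IsGenericPoint F x y) : ∃ ψ : RatFun F →ₐ[ℂ] L, ψ (xFun F) = x ∧ ψ (yFun F) = y := by
  have := h.isDomain
  refine ⟨IsFractionRing.liftAlgHom ((injective_evalAt_iff h.aevalAeval_self).2 h), ?_, ?_⟩
  · rw [xFun, IsFractionRing.liftAlgHom_apply, IsFractionRing.lift_algebraMap]
    exact (evalAt_mk h.aevalAeval_self X).trans (aevalAeval_Y _ _)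
  · rw [yFun, IsFractionRing.liftAlgHom_apply, IsFractionRing.lift_algebraMap]
    exact (evalAt_mk h.aevalAeval_self (C X)).trans (by rw [aevalAeval_C, aeval_X])

namespace CurvePoint

instance isTrivialOn (q : CurvePoint F) : q.val.IsTrivialOn ℂ := ⟨q.val_const⟩

variable [IsDomain (AdjoinRoot F)]

/-- The point below a discrete valuation of an extension of the function field. -/
def ofAlgHom {L : Type*} [Field L] [Algebra ℂ L] (v : Valuation L ℤᵐ⁰) [v.IsTrivialOn ℂ]
    (ψ : RatFun F →ₐ[ℂ] L) {f : RatFun F} (hf : v (ψ f) = WithZero.exp (-1 : ℤ)) :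
    CurvePoint F where
  val := v.comap ψ.toRingHom
  surjective γ := by
    rcases eq_or_ne γ 0 with rfl | hγ
    · exact ⟨0, map_zero _⟩
    · refine ⟨f ^ (-WithZero.log γ), ?_⟩
      change v (ψ _) = γ
      rw [map_zpow₀, map_zpow₀, hf, ← WithZero.exp_zsmul, smul_eq_mul, neg_mul_neg, mul_one,
        WithZero.exp_log hγ]
  val_const c hc := by
    change v (ψ _) = 1
    rw [ψ.commutes, Valuation.IsTrivialOn.eq_one c hc]

theorem ext_of_aevalAeval {q r : CurvePoint F}
    (h : ∀ p : ℂ[X][X], ¬ F ∣ p →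
      q.val (aevalAeval (yFun F) (xFun F) p) = r.val (aevalAeval (yFun F) (xFun F) p)) :
    q = r := by
  ext f
  obtain ⟨a, b, -, rfl⟩ := IsFractionRing.div_surjective (A := AdjoinRoot F) f
  have (a : AdjoinRoot F) :
      q.val (algebraMap _ (RatFun F) a) = r.val (algebraMap _ (RatFun F) a) := by
    obtain ⟨p, rfl⟩ := AdjoinRoot.mk_surjective a
    by_cases hp : F ∣ p
    · rw [AdjoinRoot.mk_eq_zero.2 hp, map_zero, map_zero, map_zero]
    · rw [← aevalAeval_yFun_xFun, h p hp]
  rw [map_div₀, map_div₀, this, this]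

theorem eq_exp_neg_one_of_val_eq_zpow (q : CurvePoint F) {γ : ℤᵐ⁰} (hγ : γ < 1)
    (h : ∀ p : ℂ[X][X], ¬ F ∣ p → ∃ n : ℤ, q.val (aevalAeval (yFun F) (xFun F) p) = γ ^ n) :
    γ = WithZero.exp (-1 : ℤ) := by
  have hmk {a : AdjoinRoot F} (ha : a ≠ 0) :
      ∃ n : ℤ, q.val (algebraMap _ (RatFun F) a) = γ ^ n := by
    obtain ⟨p, rfl⟩ := AdjoinRoot.mk_surjective a
    rw [← aevalAeval_yFun_xFun]
    exact h p (AdjoinRoot.mk_eq_zero.not.1 ha)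
  obtain ⟨f, hf⟩ := q.surjective (WithZero.exp (-1 : ℤ))
  obtain ⟨a, b, hb, rfl⟩ := IsFractionRing.div_surjective (A := AdjoinRoot F) f
  obtain ⟨n', hn'⟩ := hmk (nonZeroDivisors.ne_zero hb)
  obtain ⟨n, hn⟩ := hmk (a := a) (by
    rintro rfl
    rw [map_zero, zero_div, map_zero] at hf
    exact WithZero.exp_ne_zero hf.symm)
  have hγ0 : γ ≠ 0 := by
    rintro rfl
    rw [map_div₀, hn, hn', zero_zpow_eq, zero_zpow_eq] at hf
    split_ifs at hf <;>
      simp [-WithZero.exp_zero, WithZero.exp_ne_zero.symm] at hf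
  rw [map_div₀, hn, hn', ← zpow_sub₀ hγ0, ← WithZero.exp_log hγ0, ← WithZero.exp_zsmul,
    WithZero.exp_inj, smul_eq_mul] at hf
  rw [← WithZero.exp_log hγ0, ← WithZero.exp_zero, WithZero.exp_lt_exp] at hγ
  rcases Int.isUnit_iff.1 (IsUnit.of_mul_eq_one (a := γ.log) (-(n - n')) (by linarith)) with h | h
  · omega
  · rw [← WithZero.exp_log hγ0, h]

end CurvePoint

end RationalFunctions

section PlaceAtInfinity

variable {F : ℂ[X][X]} {m N : ℕ}

namespace IsCab

theorem val_eq_exp_weightedDegree [IsDomain (AdjoinRoot F)] (h : IsCab m N F) (hm : 0 < m)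
    (hN : 0 < N) (hmN : m.Coprime N) {q : CurvePoint F} (hq : q.HasPole (yFun F)) :
    (q.val (xFun F) = WithZero.exp (m : ℤ) ∧ q.val (yFun F) = WithZero.exp (N : ℤ)) ∧
      ∀ p : ℂ[X][X], ¬ F ∣ p → q.val (aevalAeval (yFun F) (xFun F) p) =
        WithZero.exp (weightedDegree m N (p %ₘ F) : ℤ) := by
  have hpow : q.val (xFun F) ^ N = q.val (yFun F) ^ m :=
    h.val_pow_eq_val_pow aevalAeval_yFun_xFun_self (lt_max_of_lt_right (one_lt_pow₀ hq hm.ne'))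
  obtain ⟨e, he, hx, hy⟩ := exists_eq_exp_of_pow_eq_pow hN hmN hpow hq
  have hval {p : ℂ[X][X]} (hp : ¬ F ∣ p) :=
    h.val_aevalAeval_eq (v := q.val) hN hmN aevalAeval_yFun_xFun_self he hx hy hp
  have hexp : WithZero.exp (-e : ℤ) = WithZero.exp (-1 : ℤ) := by
    refine q.eq_exp_neg_one_of_val_eq_zpow ?_ fun p hp =>
      ⟨-(weightedDegree m N (p %ₘ F)), (hval hp).trans ?_⟩
    · rw [← WithZero.exp_zero, WithZero.exp_lt_exp]
      omega
    · rw [← WithZero.exp_nsmul, ← WithZero.exp_zsmul]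
      simp [mul_comm]
  obtain rfl : e = 1 := by
    have := WithZero.exp_inj.1 hexp
    omega
  simp only [pow_one] at hx hy hval
  exact ⟨⟨hx, hy⟩, fun _ => hval⟩

theorem eq_of_hasPole [IsDomain (AdjoinRoot F)] (h : IsCab m N F) (hm : 0 < m) (hN : 0 < N)
    (hmN : m.Coprime N) {q r : CurvePoint F} (hq : q.HasPole (yFun F)) (hr : r.HasPole (yFun F)) :
    q = r :=
  CurvePoint.ext_of_aevalAeval fun p hp => by
    rw [(h.val_eq_exp_weightedDegree hm hN hmN hq).2 p hp,
      (h.val_eq_exp_weightedDegree hm hN hmN hr).2 p hp]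

theorem exists_hasPole (h : IsCab m N F) (hN : 0 < N) (hmN : m.Coprime N) :
    ∃ P : CurvePoint F, P.HasPole (yFun F) := by
  have := h.isDomain hN (Nat.cast_ne_zero.2 hN.ne') hmN
  obtain ⟨x, y, hF, hx, hy⟩ := h.exists_laurentSeries hN (Nat.cast_ne_zero.2 hN.ne')
  obtain ⟨ψ, hψx, hψy⟩ := (h.isGenericPoint hN hmN hF hx hy).exists_algHom
  obtain ⟨α, β, hαβ⟩ := Nat.isCoprime_iff_coprime.2 hmN
  refine ⟨.ofAlgHom Valued.v ψ (f := xFun F ^ (-α) * yFun F ^ (-β)) ?_, ?_⟩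
  · rw [map_mul, map_mul, map_zpow₀, map_zpow₀, map_zpow₀, map_zpow₀, hψx, hψy, hx, hy,
      ← WithZero.exp_zsmul, ← WithZero.exp_zsmul, ← WithZero.exp_add, ← hαβ, smul_eq_mul,
      smul_eq_mul]
    ring_nf
  · change 1 < Valued.v (ψ (yFun F))
    rw [hψy, hy, ← WithZero.exp_zero, WithZero.exp_lt_exp]
    exact_mod_cast hN

end IsCab

end PlaceAtInfinity

section Swap

variable {k : Type*} [CommRing k]

open Bivariate (swap)

theorem evalEval_swap (a b : k) (G : k[X][X]) : (swap G).evalEval a b = G.evalEval b a := by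
  rw [← coe_aevalAeval_eq_evalEval, ← coe_aevalAeval_eq_evalEval, Bivariate.aevalAeval_swap]

theorem map_evalRingHom_swap (a : k) (G : k[X][X]) :
    (swap G).map (evalRingHom a) = G.eval (C a) := by
  suffices (mapRingHom (evalRingHom a)).comp (swap (R := k) : k[X][X] →+* k[X][X]) =
    evalRingHom (C a) from DFunLike.congr_fun this G
  ext <;> simp [Bivariate.swap_C, Bivariate.swap_Y]

theorem eval_C_swap (b : k) (G : k[X][X]) : (swap G).eval (C b) = G.map (evalRingHom b) := by
  rw [← map_evalRingHom_swap, Bivariate.swap_swap_apply]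

theorem coeff_coeff_swap (G : k[X][X]) (a b : ℕ) :
    ((swap G).coeff b).coeff a = (G.coeff a).coeff b := by
  induction G using Polynomial.induction_on' with
  | add p q hp hq => simp only [map_add, coeff_add, hp, hq]
  | monomial n f =>
    induction f using Polynomial.induction_on' with
    | add p q hp hq => simp only [map_add, coeff_add, hp, hq]
    | monomial i c =>
      rw [Bivariate.swap_monomial_monomial]
      simp only [coeff_monomial]
      by_cases h1 : n = a <;> by_cases h2 : i = b <;> simp [h1, h2, coeff_monomial]

theorem IsCab.neg_swap {k : Type*} [Field k] {m N : ℕ} {F : k[X][X]} (h : IsCab m N F) :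
    IsCab N m (-swap F) := by
  intro b a hab
  have hswap : -swap F - (X ^ m - C (X ^ N)) = -swap (R := k) (F - (X ^ N - C (X ^ m))) := by
    rw [map_sub (swap (R := k)), map_sub (swap (R := k)), map_pow (swap (R := k)),
      Bivariate.swap_Y, Bivariate.swap_C, Polynomial.map_pow, map_X, C_pow]
    ring
  rw [hswap, coeff_neg, coeff_neg, coeff_coeff_swap, neg_ne_zero] at hab
  rw [add_comm, mul_comm N m]
  exact h a b hab

end Swap

section LocalParameters

variable {k : Type*}

theorem exists_taylor [CommRing k] (G : k[X][X]) (a b : k) : ∃ (G₁ : k[X][X]) (G₂ : k[X]),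
    G = C (G.eval (C a)) + (X - C (C a)) * G₁ ∧
    G.eval (C a) = C (G.evalEval b a) + (X - C b) * G₂ ∧
    G₁.evalEval b a = (derivative (G.map (evalRingHom b))).eval a ∧
    G₂.eval b = (derivative (G.eval (C a))).eval b := by
  obtain ⟨G₁, h₁⟩ : X - C (C a) ∣ G - C (G.eval (C a)) := X_sub_C_dvd_sub_C_eval
  obtain ⟨G₂, h₂⟩ : X - C b ∣ G.eval (C a) - C ((G.eval (C a)).eval b) := X_sub_C_dvd_sub_C_eval
  refine ⟨G₁, G₂, eq_add_of_sub_eq' h₁, eq_add_of_sub_eq' h₂, ?_, ?_⟩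
  · have := congrArg (fun p => (derivative (p.map (evalRingHom b))).eval a) h₁
    simp only [Polynomial.map_sub, Polynomial.map_mul, map_C, map_X, coe_evalRingHom, eval_C,
      derivative_sub, derivative_C, sub_zero, derivative_mul, derivative_X, one_mul, eval_add,
      eval_mul, eval_sub, eval_X, sub_self, zero_mul, add_zero] at this
    rw [this, map_evalRingHom_eval]
  · simpa using (congrArg (fun p => (derivative p).eval b) h₂).symm

/-- `π` generates the maximal ideal of the local ring of the plane curve `F = 0` at `(a, b)`. The
elements of the local ring are written with numerators and denominators in `k[x, y]`, and
congruences modulo `F` are written out. -/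
def IsLocalParameter [CommRing k] (F : k[X][X]) (a b : k) (π : k[X][X]) : Prop :=
  π.evalEval b a = 0 ∧ ∀ g : k[X][X], g.evalEval b a = 0 →
    ∃ s g' h : k[X][X], s.evalEval b a ≠ 0 ∧ s * g = g' * π + h * F

theorem isLocalParameter_C_X_sub_C [CommRing k] {F : k[X][X]} {a b : k} (h0 : F.evalEval b a = 0)
    (hFx : (derivative (F.map (evalRingHom b))).eval a ≠ 0) :
    IsLocalParameter F a b (C (X - C b)) := by
  refine ⟨by rw [evalEval_C, eval_sub, eval_X, eval_C, sub_self], fun g hg => ?_⟩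
  obtain ⟨F₁, F₂, hF, hFa, hF₁, -⟩ := exists_taylor F a b
  obtain ⟨g₁, g₂, hg', hga, -⟩ := exists_taylor g a b
  rw [hFa, h0, C_0, zero_add, C_mul] at hF
  rw [hga, hg, C_0, zero_add, C_mul] at hg'
  exact ⟨F₁, C g₂ * F₁ - C F₂ * g₁, g₁, by rwa [hF₁], by linear_combination F₁ * hg' - g₁ * hF⟩

theorem isLocalParameter_X_sub_C [CommRing k] {F : k[X][X]} {a b : k} (h0 : F.evalEval b a = 0)
    (hFy : (derivative (F.eval (C a))).eval b ≠ 0) :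
    IsLocalParameter F a b (X - C (C a)) := by
  refine ⟨by simp [evalEval], fun g hg => ?_⟩
  obtain ⟨F₁, F₂, hF, hFa, -, hF₂⟩ := exists_taylor F a b
  obtain ⟨g₁, g₂, hg', hga, -⟩ := exists_taylor g a b
  rw [hFa, h0, C_0, zero_add, C_mul] at hF
  rw [hga, hg, C_0, zero_add, C_mul] at hg'
  exact ⟨C F₂, C F₂ * g₁ - C g₂ * F₁, C g₂, by rwa [evalEval_C, hF₂],
    by linear_combination C F₂ * hg' - C g₂ * hF⟩

theorem IsSmoothAffine.exists_isLocalParameter {F : ℂ[X][X]} (hsm : IsSmoothAffine F) {a b : ℂ}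
    (h0 : F.evalEval b a = 0) : ∃ π, IsLocalParameter F a b π :=
  (hsm a b h0).elim (fun h => ⟨_, isLocalParameter_C_X_sub_C h0 h⟩)
    fun h => ⟨_, isLocalParameter_X_sub_C h0 h⟩

variable [Field k] {Γ₀ : Type*} [LinearOrderedCommGroupWithZero Γ₀] {L : Type*} [Field L]
  [Algebra k L] {F : k[X][X]} {v : Valuation L Γ₀} {x y : L} {a b : k}

theorem val_le_one_of_val_sub_lt_one [v.IsTrivialOn k] {z : L} {c : k}
    (h : v (z - algebraMap k L c) < 1) : v z ≤ 1 := by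
  rw [← sub_add_cancel z (algebraMap k L c)]
  exact v.map_add_le h.le (Valuation.IsTrivialOn.valuation_algebraMap_le_one v c)

theorem val_aevalAeval_le_one [v.IsTrivialOn k] (hx : v x ≤ 1) (hy : v y ≤ 1) (p : k[X][X]) :
    v (aevalAeval y x p) ≤ 1 := by
  rw [aevalAeval_eq_sum]
  refine v.map_sum_le fun i _ => v.map_sum_le fun j _ => ?_
  rw [map_mul, map_mul, map_pow, map_pow]
  exact mul_le_one' (Valuation.IsTrivialOn.valuation_algebraMap_le_one v _)
    (mul_le_one' (pow_le_one' hy _) (pow_le_one' hx _))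

/-- The centre of the valuation `v` on the affine plane, at the point with coordinates `(x, y)` in
its field, is `(a, b)`. -/
def IsCentredAt (v : Valuation L Γ₀) (x y : L) (a b : k) : Prop :=
  v (x - algebraMap k L a) < 1 ∧ v (y - algebraMap k L b) < 1

namespace IsCentredAt

theorem swap (h : IsCentredAt v x y a b) : IsCentredAt v y x b a := ⟨h.2, h.1⟩

variable [v.IsTrivialOn k]

theorem val_aevalAeval_le_one (h : IsCentredAt v x y a b) (p : k[X][X]) :
    v (aevalAeval y x p) ≤ 1 :=
  RndKP.val_aevalAeval_le_one (val_le_one_of_val_sub_lt_one h.1) (val_le_one_of_val_sub_lt_one h.2)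
    p

theorem val_aevalAeval_sub_lt (h : IsCentredAt v x y a b) (G : k[X][X]) :
    v (aevalAeval y x G - algebraMap k L (G.evalEval b a)) < 1 := by
  obtain ⟨G₁, G₂, hG, hGa, -⟩ := exists_taylor G a b
  have hdiff : aevalAeval y x G - algebraMap k L (G.evalEval b a) =
      (x - algebraMap k L a) * aevalAeval y x G₁ +
        (y - algebraMap k L b) * aevalAeval y x (C G₂) := by
    have := congrArg (aevalAeval y x) hG
    simp only [hGa, map_add, map_mul, map_sub, aevalAeval_Y, aevalAeval_C, aeval_X, aeval_C] at this
    rw [aevalAeval_C]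
    linear_combination this
  rw [hdiff]
  refine v.map_add_lt ?_ ?_ <;> rw [map_mul]
  · exact mul_lt_one_of_lt_of_le h.1 (h.val_aevalAeval_le_one _)
  · exact mul_lt_one_of_lt_of_le h.2 (h.val_aevalAeval_le_one _)

theorem val_aevalAeval_lt_one (h : IsCentredAt v x y a b) {G : k[X][X]} (hG : G.evalEval b a = 0) :
    v (aevalAeval y x G) < 1 := by
  simpa [hG] using h.val_aevalAeval_sub_lt G

theorem val_aevalAeval_eq_one (h : IsCentredAt v x y a b) {G : k[X][X]} (hG : G.evalEval b a ≠ 0) :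
    v (aevalAeval y x G) = 1 := by
  have hlt := h.val_aevalAeval_sub_lt G
  rw [← Valuation.IsTrivialOn.eq_one (v := v) _ hG] at hlt ⊢
  exact v.map_eq_of_sub_lt hlt

theorem evalEval_eq_zero (h : IsCentredAt v x y a b) (hF : aevalAeval y x F = 0) :
    F.evalEval b a = 0 := by
  by_contra h0
  have := h.val_aevalAeval_eq_one h0
  rw [hF, map_zero] at this
  exact zero_ne_one this

theorem val_aeval_eq_pow (h : IsCentredAt v x y a b) {f : k[X]} (hf : f ≠ 0) :
    v (aeval y f) = v (y - algebraMap k L b) ^ f.rootMultiplicity b := by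
  obtain ⟨g, hg, hgd⟩ := exists_eq_pow_rootMultiplicity_mul_and_not_dvd f hf b
  have hvg : v (aevalAeval y x (C g)) = 1 :=
    h.val_aevalAeval_eq_one (by rwa [evalEval_C, ne_eq, ← IsRoot.def, ← dvd_iff_isRoot])
  rw [aevalAeval_C] at hvg
  conv_lhs => rw [hg]
  rw [map_mul, map_mul, hvg, mul_one, map_pow, map_pow, map_sub, aeval_X, aeval_C]

theorem val_sub_eq_pow (h : IsCentredAt v x y a b) (hF : aevalAeval y x F = 0)
    (hF0 : F.eval (C a) ≠ 0) (hFx : (derivative (F.map (evalRingHom b))).eval a ≠ 0) :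
    v (x - algebraMap k L a) =
      v (y - algebraMap k L b) ^ (F.eval (C a)).rootMultiplicity b := by
  obtain ⟨F₁, -, hFa, -, hF₁, -⟩ := exists_taylor F a b
  rw [← hF₁] at hFx
  rw [← h.val_aeval_eq_pow hF0]
  have hxy : aeval y (F.eval (C a)) = -((x - algebraMap k L a) * aevalAeval y x F₁) := by
    rw [hFa, map_add, map_mul, map_sub, aevalAeval_Y, aevalAeval_C, aevalAeval_C, aeval_C] at hF
    exact eq_neg_of_add_eq_zero_left hF
  rw [hxy, v.map_neg, map_mul, h.val_aevalAeval_eq_one hFx, mul_one]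

end IsCentredAt

theorem IsLocalParameter.exists_mul_eq_mul_pow {v : Valuation L ℤᵐ⁰} [v.IsTrivialOn k]
    {π : k[X][X]} (hπ : IsLocalParameter F a b π) (hv : IsCentredAt v x y a b)
    (hF : aevalAeval y x F = 0) (g : k[X][X]) (hg : aevalAeval y x g ≠ 0) :
    ∃ (n : ℕ) (s u h : k[X][X]), s.evalEval b a ≠ 0 ∧ u.evalEval b a ≠ 0 ∧
      s * g = u * π ^ n + h * F := by
  induction hn : (-WithZero.log (v (aevalAeval y x g))).toNat using Nat.strong_induction_on
    generalizing g with
  | _ n ih =>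
    by_cases hg0 : g.evalEval b a = 0
    · obtain ⟨s, g', h, hs, hsg⟩ := hπ.2 g hg0
      have hval : v (aevalAeval y x g) = v (aevalAeval y x g') * v (aevalAeval y x π) := by
        have := congrArg (fun p => v (aevalAeval y x p)) hsg
        simpa only [map_add, map_mul, hF, mul_zero, add_zero, hv.val_aevalAeval_eq_one hs, one_mul]
          using this
      have hvg : v (aevalAeval y x g) ≠ 0 := v.ne_zero_iff.2 hg
      have hvπ : v (aevalAeval y x π) ≠ 0 := right_ne_zero_of_mul (hval ▸ hvg)
      have hvg' : v (aevalAeval y x g') ≠ 0 := left_ne_zero_of_mul (hval ▸ hvg)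
      have hlog := WithZero.log_mul hvg' hvπ
      have hlogπ : WithZero.log (v (aevalAeval y x π)) < 0 := by
        rw [← WithZero.exp_lt_exp, WithZero.exp_log hvπ, WithZero.exp_zero]
        exact hv.val_aevalAeval_lt_one hπ.1
      have hlogg' : WithZero.log (v (aevalAeval y x g')) ≤ 0 := by
        rw [← WithZero.exp_le_exp, WithZero.exp_log hvg', WithZero.exp_zero]
        exact hv.val_aevalAeval_le_one g'
      rw [← hval] at hlog
      obtain ⟨n', s', u, h', hs', hu, hsu⟩ := ih _ (by omega) g' (v.ne_zero_iff.1 hvg') rfl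
      refine ⟨n' + 1, s' * s, u, s' * h + h' * π, ?_, hu, ?_⟩
      · rw [evalEval_mul]
        exact mul_ne_zero hs' hs
      · linear_combination s' * hsg + π * hsu
    · exact ⟨0, 1, g, 0, by simp, hg0, by ring⟩

end LocalParameters

section AffinePoints

theorem rootMultiplicity_eq_one_of_eval_derivative_ne_zero {R : Type*} [CommRing R] {f : R[X]}
    {b : R} (hf : f ≠ 0) (h0 : f.eval b = 0) (h1 : (derivative f).eval b ≠ 0) :
    f.rootMultiplicity b = 1 := by
  have hpos : 0 < f.rootMultiplicity b := (rootMultiplicity_pos hf).2 h0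
  have hle : ¬ 1 < f.rootMultiplicity b := fun h =>
    h1 ((one_lt_rootMultiplicity_iff_isRoot hf).1 h).2
  omega

variable {F : ℂ[X][X]} {a b : ℂ}

theorem aevalAeval_yFun_xFun_ne_zero {g : ℂ[X][X]} (hg : ¬ F ∣ g) :
    aevalAeval (yFun F) (xFun F) g ≠ 0 := by
  rw [aevalAeval_yFun_xFun, ne_eq, FaithfulSMul.algebraMap_eq_zero_iff, AdjoinRoot.mk_eq_zero]
  exact hg

variable [IsDomain (AdjoinRoot F)]

theorem IsLocalParameter.exists_val_eq_pow {π : ℂ[X][X]} (hπ : IsLocalParameter F a b π)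
    {g : ℂ[X][X]} (hg : ¬ F ∣ g) {q : CurvePoint F}
    (hq : IsCentredAt q.val (xFun F) (yFun F) a b) : ∃ n : ℕ, ∀ r : CurvePoint F,
    IsCentredAt r.val (xFun F) (yFun F) a b → r.val (aevalAeval (yFun F) (xFun F) g) =
      r.val (aevalAeval (yFun F) (xFun F) π) ^ n := by
  obtain ⟨n, s, u, h, hs, hu, hsu⟩ := hπ.exists_mul_eq_mul_pow hq aevalAeval_yFun_xFun_self g
    (aevalAeval_yFun_xFun_ne_zero hg)
  refine ⟨n, fun r hr => ?_⟩
  have := congrArg (fun p => r.val (aevalAeval (yFun F) (xFun F) p)) hsu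
  simpa only [map_add, map_mul, map_pow, aevalAeval_yFun_xFun_self, mul_zero, add_zero,
    hr.val_aevalAeval_eq_one hs, hr.val_aevalAeval_eq_one hu, one_mul] using this

theorem IsLocalParameter.val_eq {π : ℂ[X][X]} (hπ : IsLocalParameter F a b π) {q : CurvePoint F}
    (hq : IsCentredAt q.val (xFun F) (yFun F) a b) :
    q.val (aevalAeval (yFun F) (xFun F) π) = WithZero.exp (-1 : ℤ) :=
  q.eq_exp_neg_one_of_val_eq_zpow (hq.val_aevalAeval_lt_one hπ.1) fun g hg => by
    obtain ⟨n, hn⟩ := hπ.exists_val_eq_pow hg hq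
    exact ⟨n, by rw [hn q hq, zpow_natCast]⟩

theorem IsSmoothAffine.eq_of_isCentredAt (hsm : IsSmoothAffine F) {q r : CurvePoint F}
    (hq : IsCentredAt q.val (xFun F) (yFun F) a b) (hr : IsCentredAt r.val (xFun F) (yFun F) a b) :
    q = r := by
  obtain ⟨π, hπ⟩ := hsm.exists_isLocalParameter (hq.evalEval_eq_zero aevalAeval_yFun_xFun_self)
  refine CurvePoint.ext_of_aevalAeval fun g hg => ?_
  obtain ⟨n, hn⟩ := hπ.exists_val_eq_pow hg hq
  rw [hn q hq, hn r hr, hπ.val_eq hq, hπ.val_eq hr]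

theorem CurvePoint.hasOrder_xFun_sub (hsm : IsSmoothAffine F) (hF0 : F.eval (C a) ≠ 0)
    {q : CurvePoint F} (hq : IsCentredAt q.val (xFun F) (yFun F) a b) :
    q.HasOrder (xFun F - algebraMap ℂ _ a) ((F.eval (C a)).rootMultiplicity b) := by
  have h0 := hq.evalEval_eq_zero aevalAeval_yFun_xFun_self
  rw [CurvePoint.HasOrder]
  by_cases hFx : (derivative (F.map (evalRingHom b))).eval a = 0
  · have hFy := (hsm a b h0).resolve_left (not_not.2 hFx)
    have hval := (isLocalParameter_X_sub_C h0 hFy).val_eq hq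
    rw [map_sub, aevalAeval_Y, aevalAeval_C, aeval_C] at hval
    rw [hval, rootMultiplicity_eq_one_of_eval_derivative_ne_zero hF0 h0 hFy, Nat.cast_one]
  · have hval := (isLocalParameter_C_X_sub_C h0 hFx).val_eq hq
    rw [aevalAeval_C, map_sub, aeval_X, aeval_C] at hval
    rw [hq.val_sub_eq_pow aevalAeval_yFun_xFun_self hF0 hFx, hval, ← WithZero.exp_nsmul,
      nsmul_eq_mul, mul_neg_one]

theorem CurvePoint.hasOrder_yFun_sub (hsm : IsSmoothAffine F) (hF0 : F.map (evalRingHom b) ≠ 0)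
    {q : CurvePoint F} (hq : IsCentredAt q.val (xFun F) (yFun F) a b) :
    q.HasOrder (yFun F - algebraMap ℂ _ b) ((F.map (evalRingHom b)).rootMultiplicity a) := by
  have h0 := hq.evalEval_eq_zero aevalAeval_yFun_xFun_self
  rw [CurvePoint.HasOrder]
  by_cases hFy : (derivative (F.eval (C a))).eval b = 0
  · have hFx := (hsm a b h0).resolve_right (not_not.2 hFy)
    have hval := (isLocalParameter_C_X_sub_C h0 hFx).val_eq hq
    rw [aevalAeval_C, map_sub, aeval_X, aeval_C] at hval
    rw [hval, rootMultiplicity_eq_one_of_eval_derivative_ne_zero hF0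
      (by rwa [map_evalRingHom_eval]) hFx, Nat.cast_one]
  · have hval := (isLocalParameter_X_sub_C h0 hFy).val_eq hq
    rw [map_sub, aevalAeval_Y, aevalAeval_C, aeval_C] at hval
    have hpow := hq.swap.val_sub_eq_pow (F := Bivariate.swap F)
      (by rw [Bivariate.aevalAeval_swap, aevalAeval_yFun_xFun_self]) (by rwa [eval_C_swap])
      (by rwa [map_evalRingHom_swap])
    rw [hpow, hval, eval_C_swap, ← WithZero.exp_nsmul, nsmul_eq_mul, mul_neg_one]

end AffinePoints

section ExistenceOfAffinePoints

variable {k : Type*} [Field k] {L : Type*} [Field L] [Algebra k L] {m N : ℕ} {F : k[X][X]}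

theorem IsGenericPoint.of_neg_swap {x y : L} (h : IsGenericPoint (-Bivariate.swap F) y x) :
    IsGenericPoint F x y := fun p => by
  rw [← Bivariate.aevalAeval_swap, h]
  exact neg_dvd.trans (map_dvd_iff Bivariate.swap)

theorem IsGenericPoint.of_transcendental [IsDomain (AdjoinRoot F)] (hmon : F.Monic) {x y : L}
    (hF : aevalAeval y x F = 0) (hy : Transcendental k y) : IsGenericPoint F x y := by
  have := hmon.finite_adjoinRoot
  rw [← injective_evalAt_iff hF, injective_iff_map_eq_zero]
  have hker : RingHom.ker (evalAt hF) = ⊥ := by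
    refine Ideal.eq_bot_of_comap_eq_bot (R := k[X]) (eq_bot_iff.2 fun f hf => ?_)
    have hf0 : evalAt hF (AdjoinRoot.mk F (C f)) = 0 := hf
    rw [evalAt_mk, aevalAeval_C] at hf0
    exact transcendental_iff.1 hy f hf0
  exact fun g hg => hker.le hg

theorem exp_neg_one_lt_one : WithZero.exp (-1 : ℤ) < 1 := by
  rw [← WithZero.exp_zero, WithZero.exp_lt_exp]
  exact neg_one_lt_zero

theorem transcendental_of_val_sub_eq_exp {v : Valuation L ℤᵐ⁰} [v.IsTrivialOn k] {y : L} {b : k}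
    (hv : v (y - algebraMap k L b) = WithZero.exp (-1 : ℤ)) : Transcendental k y := fun hy =>
  Valuation.transcendental_of_ne_one (A := k) (v := v) (y - algebraMap k L b)
    (v.ne_zero_iff.1 (hv.trans_ne WithZero.exp_ne_zero)) (hv.trans_ne exp_neg_one_lt_one.ne)
    (hy.sub (isAlgebraic_algebraMap b))

theorem IsCab.exists_isGenericPoint (h : IsCab m N F) (hN : 0 < N) (hNk : (N : k) ≠ 0)
    (hmN : m.Coprime N) {a b : k} (h0 : F.evalEval b a = 0)
    (hFx : (derivative (F.map (evalRingHom b))).eval a ≠ 0) :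
    ∃ x y : LaurentSeries k, IsGenericPoint F x y ∧ IsCentredAt Valued.v x y a b ∧
      Valued.v (y - algebraMap k (LaurentSeries k) b) = WithZero.exp (-1 : ℤ) := by
  have := h.isDomain hN hNk hmN
  obtain ⟨ξ, hξ, hF⟩ := exists_powerSeries_root (h.monic hN) h0 hFx
  set ι := powerSeriesToLaurent k with hι
  set T : LaurentSeries k := ι PowerSeries.X with hT
  have hC (c : k) : ι (PowerSeries.C c) = algebraMap k (LaurentSeries k) c := ι.commutes c
  have hvT : Valued.v T = WithZero.exp (-1 : ℤ) := by
    rw [hT, hι, powerSeriesToLaurent_X, LaurentSeries.valuation_single_zpow]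
  have hb : Valued.v (algebraMap k (LaurentSeries k) b + T - algebraMap k (LaurentSeries k) b) =
      WithZero.exp (-1 : ℤ) := by rw [add_sub_cancel_left, hvT]
  refine ⟨ι ξ, algebraMap k _ b + T, .of_transcendental (h.monic hN) ?_
    (transcendental_of_val_sub_eq_exp hb), ⟨?_, hb.trans_lt exp_neg_one_lt_one⟩, hb⟩
  · rw [hT, ← hC, ← map_add, ← map_aevalAeval, hF, map_zero]
  · rw [← hC, ← map_sub, val_powerSeriesToLaurent_lt_one_iff, map_sub, hξ,
      PowerSeries.constantCoeff_C, sub_self]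

theorem IsGenericPoint.exists_curvePoint {F : ℂ[X][X]} [IsDomain (AdjoinRoot F)] [Algebra ℂ L]
    {x y : L} (h : IsGenericPoint F x y) {v : Valuation L ℤᵐ⁰} [v.IsTrivialOn ℂ] {p : ℂ[X][X]}
    (hp : v (aevalAeval y x p) = WithZero.exp (-1 : ℤ)) {a b : ℂ} (hv : IsCentredAt v x y a b) :
    ∃ P : CurvePoint F, IsCentredAt P.val (xFun F) (yFun F) a b := by
  obtain ⟨ψ, hψx, hψy⟩ := h.exists_algHom
  refine ⟨.ofAlgHom v ψ (f := aevalAeval (yFun F) (xFun F) p) ?_, ?_, ?_⟩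
  · rwa [map_aevalAeval, hψx, hψy]
  · change v (ψ _) < 1
    rw [map_sub, hψx, ψ.commutes]
    exact hv.1
  · change v (ψ _) < 1
    rw [map_sub, hψy, ψ.commutes]
    exact hv.2

theorem IsCab.exists_isPointAt {F : ℂ[X][X]} (h : IsCab m N F) (hm : 0 < m) (hN : 0 < N)
    (hmN : m.Coprime N) (hsm : IsSmoothAffine F) {a b : ℂ} (h0 : F.evalEval b a = 0) :
    ∃ P : CurvePoint F, P.IsPointAt a b := by
  have := h.isDomain hN (Nat.cast_ne_zero.2 hN.ne') hmN
  suffices ∃ P : CurvePoint F, IsCentredAt P.val (xFun F) (yFun F) a b from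
    this.imp fun P hP => ⟨hP, fun q hqx hqy => hsm.eq_of_isCentredAt ⟨hqx, hqy⟩ hP⟩
  rcases hsm a b h0 with hFx | hFy
  · obtain ⟨x, y, hxy, hv, hy⟩ :=
      h.exists_isGenericPoint hN (Nat.cast_ne_zero.2 hN.ne') hmN h0 hFx
    exact hxy.exists_curvePoint (p := C (X - C b))
      (by rwa [aevalAeval_C, map_sub, aeval_X, aeval_C]) hv
  · obtain ⟨y, x, hxy, hv, hx⟩ := h.neg_swap.exists_isGenericPoint (a := b) (b := a) hm
      (Nat.cast_ne_zero.2 hm.ne') hmN.symm (by rw [evalEval_neg, evalEval_swap, h0, neg_zero])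
      (by rwa [Polynomial.map_neg, map_evalRingHom_swap, derivative_neg, eval_neg, neg_ne_zero])
    exact hxy.of_neg_swap.exists_curvePoint (p := X - C (C a))
      (by rwa [map_sub, aevalAeval_Y, aevalAeval_C, aeval_C]) hv.swap

end ExistenceOfAffinePoints

section ZeroDivisors

section Centres

variable {k : Type*} [Field k] {Γ₀ : Type*} [LinearOrderedCommGroupWithZero Γ₀] {L : Type*}
  [Field L] [Algebra k L] {v : Valuation L Γ₀} {x y : L} {m N : ℕ} {F : k[X][X]} {a b : k}

theorem IsCab.map_evalRingHom_ne_zero (h : IsCab m N F) (hN : 0 < N) (b : k) :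
    F.map (evalRingHom b) ≠ 0 :=
  ((h.monic hN).map _).ne_zero

theorem IsCab.eval_C_ne_zero (h : IsCab m N F) (hm : 0 < m) (a : k) : F.eval (C a) ≠ 0 := by
  have := h.neg_swap.map_evalRingHom_ne_zero hm a
  rwa [Polynomial.map_neg, map_evalRingHom_swap, neg_ne_zero] at this

variable [IsAlgClosed k]

theorem exists_val_sub_lt_one [v.IsTrivialOn k] {f : k[X]} (hf : f ≠ 0)
    (h : v (aeval y f) < 1) : ∃ b, v (y - algebraMap k L b) < 1 := by
  contrapose! h
  rw [(IsAlgClosed.splits f).eq_prod_roots, map_mul, aeval_C, map_mul,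
    Valuation.IsTrivialOn.eq_one _ (leadingCoeff_ne_zero.2 hf), one_mul, map_multiset_prod,
    map_multiset_prod, Multiset.map_map, Multiset.map_map]
  refine Multiset.one_le_prod_of_one_le fun _ hμ => ?_
  obtain ⟨b, -, rfl⟩ := Multiset.mem_map.1 hμ
  simpa using h b

variable [v.IsTrivialOn k]

theorem IsCab.exists_isCentredAt_of_val_fst (h : IsCab m N F) (hm : 0 < m) (hN : 0 < N)
    (hF : aevalAeval y x F = 0) (hx : v (x - algebraMap k L a) < 1) :
    ∃ b : k, IsCentredAt v x y a b := by
  have hx1 : v x ≤ 1 := val_le_one_of_val_sub_lt_one hx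
  have hy1 : v y ≤ 1 := not_lt.1 (mt (h.one_lt_val_iff hm hN hF).2 hx1.not_gt)
  obtain ⟨F₁, -, hFa, -⟩ := exists_taylor F a 0
  have hfy : aeval y (F.eval (C a)) = -((x - algebraMap k L a) * aevalAeval y x F₁) := by
    rw [hFa, map_add, map_mul, map_sub, aevalAeval_Y, aevalAeval_C, aevalAeval_C, aeval_C] at hF
    exact eq_neg_of_add_eq_zero_left hF
  have hlt : v (aeval y (F.eval (C a))) < 1 := by
    rw [hfy, v.map_neg, map_mul]
    exact mul_lt_one_of_lt_of_le hx (val_aevalAeval_le_one hx1 hy1 F₁)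
  exact (exists_val_sub_lt_one (h.eval_C_ne_zero hm a) hlt).imp fun b hb => ⟨hx, hb⟩

theorem IsCab.exists_isCentredAt_of_val_snd (h : IsCab m N F) (hm : 0 < m) (hN : 0 < N)
    (hF : aevalAeval y x F = 0) (hy : v (y - algebraMap k L b) < 1) :
    ∃ a : k, IsCentredAt v x y a b :=
  (h.neg_swap.exists_isCentredAt_of_val_fst hN hm
    (by rw [map_neg, Bivariate.aevalAeval_swap, hF, neg_zero]) hy).imp fun _ => IsCentredAt.swap

end Centres

theorem rootMultiplicity_C_mul_prod_X_sub_C {k : Type*} [Field k] {ι : Type*} [Fintype ι]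
    {c : k} (hc : c ≠ 0) (r : ι → k) (b : k) :
    (C c * ∏ j, (X - C (r j))).rootMultiplicity b = {j | r j = b}.ncard := by
  classical
  have hprod : ∏ j, (X - C (r j)) = ((Finset.univ.val.map r).map fun a => X - C a).prod := by
    rw [Multiset.map_map]
    rfl
  rw [← count_roots, roots_C_mul _ hc, hprod, roots_multiset_prod_X_sub_C, Multiset.count_map,
    Set.ncard_eq_toFinset_card', Set.toFinset_ofPred, ← Finset.filter_val, Finset.card_val]
  simp only [eq_comm]

variable {F : ℂ[X][X]} {a b : ℂ} {m N : ℕ}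

namespace CurvePoint

theorem HasValue.unique {p : CurvePoint F} {f : RatFun F} {c c' : ℂ} (h : p.HasValue f c)
    (h' : p.HasValue f c') : c = c' := by
  by_contra hne
  have hlt := p.val.map_sub_lt h' h
  rw [sub_sub_sub_cancel_left, ← map_sub, p.val_const _ (sub_ne_zero.2 hne)] at hlt
  exact hlt.false

theorem IsPointAt.eq_iff {p q : CurvePoint F} (hq : q.IsPointAt a b) {a' b' : ℂ}
    (hpx : p.HasValue (xFun F) a') (hpy : p.HasValue (yFun F) b') : q = p ↔ a = a' ∧ b = b' := by
  constructor
  · rintro rfl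
    exact ⟨hq.1.1.unique hpx, hq.1.2.unique hpy⟩
  · rintro ⟨rfl, rfl⟩
    exact (hq.2 p hpx hpy).symm

end CurvePoint

variable {ι : Type*} [Fintype ι] {r : ι → ℂ} {c : ℂ}

theorem IsCab.exists_zeros_xFun_sub (h : IsCab m N F) (hm : 0 < m) (hN : 0 < N)
    (hmN : m.Coprime N) (hsm : IsSmoothAffine F)
    (hF : F.eval (C a) = C c * ∏ j, (X - C (r j))) :
    ∃ P : ι → CurvePoint F, (∀ j, (P j).IsPointAt a (r j)) ∧
      ∀ p : CurvePoint F, p.HasValue (xFun F) a →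
        p.HasOrder (xFun F - algebraMap ℂ _ a) {j | P j = p}.ncard := by
  have := h.isDomain hN (Nat.cast_ne_zero.2 hN.ne') hmN
  have hF0 := h.eval_C_ne_zero hm a
  have hc : c ≠ 0 := C_ne_zero.1 (left_ne_zero_of_mul (hF.symm.trans_ne hF0))
  have hroot (j : ι) : F.evalEval (r j) a = 0 := by
    rw [evalEval, hF, eval_mul, eval_prod, Finset.prod_eq_zero (Finset.mem_univ j) (by simp),
      mul_zero]
  choose P hP using fun j => h.exists_isPointAt hm hN hmN hsm (hroot j)
  refine ⟨P, hP, fun p hpx => ?_⟩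
  obtain ⟨b, hp⟩ :=
    h.exists_isCentredAt_of_val_fst (v := p.val) hm hN aevalAeval_yFun_xFun_self hpx
  have hset : {j | P j = p} = {j | r j = b} := by
    ext j
    exact ((hP j).eq_iff hp.1 hp.2).trans (and_iff_right rfl)
  rw [hset, ← rootMultiplicity_C_mul_prod_X_sub_C hc, ← hF]
  exact CurvePoint.hasOrder_xFun_sub hsm hF0 hp

theorem IsCab.exists_zeros_yFun_sub (h : IsCab m N F) (hm : 0 < m) (hN : 0 < N)
    (hmN : m.Coprime N) (hsm : IsSmoothAffine F)
    (hF : F.map (evalRingHom b) = C c * ∏ j, (X - C (r j))) :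
    ∃ P : ι → CurvePoint F, (∀ j, (P j).IsPointAt (r j) b) ∧
      ∀ p : CurvePoint F, p.HasValue (yFun F) b →
        p.HasOrder (yFun F - algebraMap ℂ _ b) {j | P j = p}.ncard := by
  have := h.isDomain hN (Nat.cast_ne_zero.2 hN.ne') hmN
  have hF0 := h.map_evalRingHom_ne_zero hN b
  have hc : c ≠ 0 := C_ne_zero.1 (left_ne_zero_of_mul (hF.symm.trans_ne hF0))
  have hroot (j : ι) : F.evalEval b (r j) = 0 := by
    rw [← map_evalRingHom_eval, hF, eval_mul, eval_prod,
      Finset.prod_eq_zero (Finset.mem_univ j) (by simp), mul_zero]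
  choose P hP using fun j => h.exists_isPointAt hm hN hmN hsm (hroot j)
  refine ⟨P, hP, fun p hpy => ?_⟩
  obtain ⟨a, hp⟩ :=
    h.exists_isCentredAt_of_val_snd (v := p.val) hm hN aevalAeval_yFun_xFun_self hpy
  have hset : {j | P j = p} = {j | r j = a} := by
    ext j
    exact ((hP j).eq_iff hp.1 hp.2).trans (and_iff_left rfl)
  rw [hset, ← rootMultiplicity_C_mul_prod_X_sub_C hc, ← hF]
  exact CurvePoint.hasOrder_yFun_sub hsm hF0 hp

end ZeroDivisors

section LaxZeros

theorem cyclicCurve_eval_zero {N : ℕ} [NeZero N] (ds : List (Fin N → ℂ)) : ∃ c : ℂ,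
    (cyclicCurve ds).eval (C 0) =
      C c * (ds.map fun d => X - C ((-1) ^ N * ∏ i, d i)).prod := by
  have hfactor (d : Fin N → ℂ) : ∏ i, C (d i) - (-1) ^ N * X =
      C (-(-1) ^ N) * (X - C ((-1) ^ N * ∏ i, d i)) := by
    have hsq : (-1 : ℂ[X]) ^ N * (-1) ^ N = 1 := by rw [← mul_pow]; simp
    simp only [map_neg, map_mul, map_pow, map_one, map_prod]
    linear_combination (-∏ i, C (d i)) * hsq
  refine ⟨(-1) ^ N * (-(-1) ^ N) ^ ds.length, ?_⟩
  rw [cyclicCurve, Matrix.eval_charpoly, C_0, map_zero, zero_sub, Matrix.det_neg,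
    Fintype.card_fin, det_cyclicProd, List.map_map]
  simp only [Function.comp_def, hfactor, List.prod_map_mul, List.map_const', List.prod_replicate,
    map_mul, map_pow, map_neg, map_one, mul_assoc]

theorem cyclicCurve_map_eval_zero {N : ℕ} (ds : List (Fin N → ℂ)) :
    (cyclicCurve ds).map (evalRingHom 0) = ∏ i, (X - C (ds.map (· i)).prod) := by
  rw [cyclicCurve, charpoly_cyclicProd_map, List.map_map, coe_evalRingHom, eval_X]
  simp only [Function.comp_def, eval_C, List.map_id', charpoly_cyclicProd_zero_right]

variable {M K N : ℕ} [NeZero N] {I V : ℤ → ℤ → ℂ}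

theorem cyclicCurve_laxDiagonals_eval_zero : ∃ c : ℂ,
    (cyclicCurve (laxDiagonals M K N I V 0)).eval (C 0) = C c * ∏ j : Fin M ⊕ Fin K,
      (X - C (Sum.elim (fun j : Fin M => (-1) ^ N * ∏ i : Fin N, I (i + 1) (-(j * K)))
        (fun j : Fin K => (-1) ^ N * ∏ i : Fin N, V (i + 1) (-(j * M))) j)) := by
  obtain ⟨c, h⟩ := cyclicCurve_eval_zero (laxDiagonals M K N I V 0)
  refine ⟨c, ?_⟩
  rw [h, laxDiagonals, List.map_append, List.prod_append, List.map_reverse, List.map_reverse,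
    List.prod_reverse, List.map_map, List.map_map, mul_comm (List.prod _), Fintype.prod_sum_type]
  simp only [Sum.elim_inl, Sum.elim_inr]
  rw [Fin.prod_univ_eq_prod_range
      (fun j : ℕ => X - C ((-1) ^ N * ∏ i : Fin N, I (i + 1) (-(j * K)))),
    Fin.prod_univ_eq_prod_range
      (fun j : ℕ => X - C ((-1) ^ N * ∏ i : Fin N, V (i + 1) (-(j * M))))]
  simp only [Function.comp_def, zero_sub]
  rfl

theorem ncard_setOf_sum {α β : Type*} [Finite α] [Finite β] (p : α ⊕ β → Prop) :
    {j | p j}.ncard = {a | p (.inl a)}.ncard + {b | p (.inr b)}.ncard :=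
  (Nat.card_congr Equiv.subtypeSum).trans Nat.card_sum

theorem exists_zeros_xFun_laxDiagonals (hm : 0 < M + K) (hmN : (M + K).Coprime N)
    (hsm : IsSmoothAffine (cyclicCurve (laxDiagonals M K N I V 0))) :
    ∃ (A : Fin M → CurvePoint (cyclicCurve (laxDiagonals M K N I V 0)))
      (B : Fin K → CurvePoint (cyclicCurve (laxDiagonals M K N I V 0))),
      (∀ j, (A j).IsPointAt 0 ((-1) ^ N * ∏ i : Fin N, I (i + 1) (-(j * K)))) ∧
      (∀ j, (B j).IsPointAt 0 ((-1) ^ N * ∏ i : Fin N, V (i + 1) (-(j * M)))) ∧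
      ∀ p : CurvePoint _, p.HasValue (xFun _) 0 →
        p.HasOrder (xFun _) ({j | A j = p}.ncard + {j | B j = p}.ncard) := by
  rw [← length_laxDiagonals (I := I) (V := V) (N := N) 0] at hm hmN
  obtain ⟨c, hc⟩ := cyclicCurve_laxDiagonals_eval_zero (M := M) (K := K) (N := N) (I := I) (V := V)
  obtain ⟨P, hP, hx⟩ :=
    (isCab_cyclicCurve _ hmN).exists_zeros_xFun_sub hm (NeZero.pos N) hmN hsm hc
  refine ⟨fun j => P (.inl j), fun j => P (.inr j), fun j => hP (.inl j), fun j => hP (.inr j),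
    fun p hp => ?_⟩
  simpa only [map_zero, sub_zero, ncard_setOf_sum, Nat.cast_add] using hx p hp

theorem exists_zeros_yFun_laxDiagonals (t : ℤ) (hm : 0 < M + K) (hmN : (M + K).Coprime N)
    (hsm : IsSmoothAffine (cyclicCurve (laxDiagonals M K N I V t))) :
    ∃ Q : Fin N → CurvePoint (cyclicCurve (laxDiagonals M K N I V t)),
      (∀ j, (Q j).IsPointAt ((laxDiagonals M K N I V t).map (· j)).prod 0) ∧
      ∀ p : CurvePoint _, p.HasValue (yFun _) 0 → p.HasOrder (yFun _) {j | Q j = p}.ncard := by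
  rw [← length_laxDiagonals (I := I) (V := V) (N := N) t] at hm hmN
  obtain ⟨Q, hQ, hy⟩ := (isCab_cyclicCurve _ hmN).exists_zeros_yFun_sub (c := 1) hm (NeZero.pos N)
    hmN hsm (by rw [cyclicCurve_map_eval_zero, C_1, one_mul])
  exact ⟨Q, hQ, by simpa only [map_zero, sub_zero] using hy⟩

end LaxZeros

section LocalCoordinate

section Valuation

variable {L : Type*} [Field L] {v : Valuation L ℤᵐ⁰} {m N : ℕ} {x y : L}

theorem val_zpow_sub_one_lt_one {Γ₀ : Type*} [LinearOrderedCommGroupWithZero Γ₀]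
    {v : Valuation L Γ₀} {ρ : L} (h : v (ρ - 1) < 1) (n : ℤ) : v (ρ ^ n - 1) < 1 := by
  have hρ : ρ ≠ 0 := by
    rintro rfl
    simp at h
  have hv := v.isEquiv_valuation_valuationSubring
  have hmem : Units.mk0 ρ hρ ∈ v.valuationSubring.principalUnitGroup := hv.lt_one_iff_lt_one.1 h
  have hpow : Units.mk0 ρ hρ ^ n ∈ v.valuationSubring.principalUnitGroup := zpow_mem hmem n
  rw [ValuationSubring.mem_principalUnitGroup_iff, Units.val_zpow_eq_zpow_val] at hpow
  exact hv.lt_one_iff_lt_one.2 hpow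

theorem mul_zpow_eq_div_zpow {G : Type*} [CommGroupWithZero G] {x y : G} (hx : x ≠ 0)
    {α β m N : ℤ} (h : α * m + β * N = 1) :
    x * (x ^ (-α) * y ^ (-β)) ^ m = (x ^ N / y ^ m) ^ β := by
  rw [mul_zpow, ← zpow_mul, ← zpow_mul, ← mul_assoc, ← zpow_one_add₀ hx, div_zpow, ← zpow_mul,
    ← zpow_mul, div_eq_mul_inv, ← zpow_neg]
  congr 2
  · linear_combination -h
  · ring

theorem exists_localCoordinate (hmN : m.Coprime N) (hx : v x = WithZero.exp (m : ℤ))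
    (hy : v y = WithZero.exp (N : ℤ)) (hxy : v (x ^ N - y ^ m) < v (y ^ m)) :
    ∃ κ : L, v κ = WithZero.exp (-1 : ℤ) ∧ v (x * κ ^ m - 1) < 1 ∧ v (y * κ ^ N - 1) < 1 := by
  obtain ⟨α, β, hαβ⟩ := Nat.isCoprime_iff_coprime.2 hmN
  have hx0 : x ≠ 0 := v.ne_zero_iff.1 (hx.trans_ne WithZero.exp_ne_zero)
  have hy0 : y ≠ 0 := v.ne_zero_iff.1 (hy.trans_ne WithZero.exp_ne_zero)
  have hρ : v (x ^ N / y ^ m - 1) < 1 := by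
    rwa [div_sub_one (pow_ne_zero m hy0), map_div₀,
      div_lt_one₀ (zero_lt_iff.2 (v.ne_zero_iff.2 (pow_ne_zero m hy0)))]
  refine ⟨x ^ (-α) * y ^ (-β), ?_, ?_, ?_⟩
  · rw [map_mul, map_zpow₀, map_zpow₀, hx, hy, ← WithZero.exp_zsmul, ← WithZero.exp_zsmul,
      ← WithZero.exp_add, ← hαβ, smul_eq_mul, smul_eq_mul]
    ring_nf
  · have := val_zpow_sub_one_lt_one hρ β
    rwa [← zpow_natCast, ← zpow_natCast, ← mul_zpow_eq_div_zpow hx0 hαβ, zpow_natCast] at this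
  · have := val_zpow_sub_one_lt_one hρ (-α)
    rwa [← inv_zpow', inv_div, ← zpow_natCast, ← zpow_natCast,
      ← mul_zpow_eq_div_zpow hy0 ((add_comm _ _).trans hαβ), zpow_natCast, mul_comm (y ^ _)] at this

end Valuation

variable {F : ℂ[X][X]} {m N : ℕ}

theorem CurvePoint.leadingTerm_zpow_neg_iff {P : CurvePoint F} {z : RatFun F} {κ : (RatFun F)ˣ}
    {n : ℕ} : P.LeadingTerm z ↑(κ ^ (-(n : ℤ))) ↔ P.val (z * κ ^ n - 1) < 1 := by
  have hκ : 0 < P.val ↑(κ ^ n) := zero_lt_iff.2 ((κ ^ n).isUnit.map P.val).ne_zero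
  rw [CurvePoint.LeadingTerm, zpow_neg, zpow_natCast, ← mul_lt_mul_iff_left₀ hκ, ← map_mul,
    ← map_mul, sub_mul, Units.inv_mul, map_one, Units.val_pow_eq_pow_val]

theorem IsCab.exists_place_at_infinity (h : IsCab m N F) (hm : 0 < m) (hN : 0 < N)
    (hmN : m.Coprime N) : ∃ P : CurvePoint F, (P.HasPole (xFun F) ∧ P.HasPole (yFun F)) ∧
      (∀ p : CurvePoint F, p.HasPole (xFun F) ∨ p.HasPole (yFun F) → p = P) ∧
      ∃ κ : (RatFun F)ˣ, P.HasOrder (κ : RatFun F) 1 ∧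
        P.LeadingTerm (xFun F) ↑(κ ^ (-(m : ℤ))) ∧ P.LeadingTerm (yFun F) ↑(κ ^ (-(N : ℤ))) := by
  have := h.isDomain hN (Nat.cast_ne_zero.2 hN.ne') hmN
  have hiff (p : CurvePoint F) : p.HasPole (xFun F) ↔ p.HasPole (yFun F) :=
    h.one_lt_val_iff (v := p.val) hm hN aevalAeval_yFun_xFun_self
  obtain ⟨P, hP⟩ := h.exists_hasPole hN hmN
  obtain ⟨⟨hx, hy⟩, -⟩ := h.val_eq_exp_weightedDegree hm hN hmN hP
  have hmax : 1 < max (P.val (xFun F) ^ N) (P.val (yFun F) ^ m) :=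
    lt_max_of_lt_right (one_lt_pow₀ hP hm.ne')
  have hlt := h.val_pow_sub_pow_lt (v := P.val) aevalAeval_yFun_xFun_self hmax
  rw [h.val_pow_eq_val_pow (v := P.val) aevalAeval_yFun_xFun_self hmax, max_self, ← map_pow] at hlt
  obtain ⟨κ, hκ, hκx, hκy⟩ := exists_localCoordinate (v := P.val) hmN hx hy hlt
  exact ⟨P, ⟨(hiff P).2 hP, hP⟩,
    fun p hp => h.eq_of_hasPole hm hN hmN (hp.elim (hiff p).1 id) hP,
    Units.mk0 κ (P.val.ne_zero_iff.1 (hκ.trans_ne WithZero.exp_ne_zero)), hκ,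
    CurvePoint.leadingTerm_zpow_neg_iff.2 hκx, CurvePoint.leadingTerm_zpow_neg_iff.2 hκy⟩

end LocalCoordinate

section Eigenvectors

theorem eq_apply_zero_of_periodic {α : Type*} {m N : ℕ} [NeZero N] (hm : m.Coprime N)
    {u : Fin N → α} (h : Function.Periodic u (m • 1)) (i : Fin N) : u i = u 0 := by
  obtain ⟨j, rfl⟩ := (nsmulCoprime (n := m) (G := Fin N) (by simpa using hm.symm)).surjective i
  have hj : (j : ℕ) • (1 : Fin N) = j := by
    open scoped Fin.CommRing in rw [nsmul_one, Fin.cast_val_eq_self]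
  rw [nsmulCoprime_apply, ← hj, smul_comm, ← zero_add ((j : ℕ) • m • (1 : Fin N))]
  exact h.nsmul j 0

section Valuation

variable {L : Type*} [Field L] {Γ₀ : Type*} [LinearOrderedCommGroupWithZero Γ₀]
  {v : Valuation L Γ₀} {N : ℕ} {ds : List (Fin N → L)} {x y κ : L} {u w : Fin N → L}

theorem cyclicProd_map_smul_mulVec (hκ : κ ≠ 0) (h : (cyclicProd ds y).mulVec w = x • w) :
    (cyclicProd (ds.map (κ • ·)) (y * κ ^ N)).mulVec (fun i => κ ^ (i : ℕ) * w i) =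
      (x * κ ^ ds.length) • fun i : Fin N => κ ^ (i : ℕ) * w i := by
  have hdiag (u : Fin N → L) : (Matrix.diagonal fun i : Fin N => κ⁻¹ ^ (i : ℕ)).mulVec u =
      fun i : Fin N => κ⁻¹ ^ (i : ℕ) * u i := funext (Matrix.mulVec_diagonal _ u)
  have hconj := congrArg (·.mulVec fun i : Fin N => κ ^ (i : ℕ) * w i)
    (cyclicProd_mul_diagonal (mul_inv_cancel₀ hκ) ds y)
  simp only [← Matrix.mulVec_mulVec, Matrix.smul_mulVec, hdiag] at hconj
  simp only [inv_pow, inv_mul_cancel_left₀ (pow_ne_zero _ hκ), h] at hconj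
  ext i
  have hi := congrFun hconj i
  simp only [Pi.smul_apply, smul_eq_mul] at hi ⊢
  have hκi := pow_ne_zero (i : ℕ) hκ
  have hκm := pow_ne_zero ds.length hκ
  field_simp at hi
  linear_combination -hi

variable [NeZero N]

theorem val_mul_lt {a b : L} {γ : Γ₀} (hγ : γ ≠ 0) (ha : v a < 1) (hb : v b ≤ γ) :
    v (a * b) < γ := by
  rw [map_mul]
  exact (mul_le_mul_right hb _).trans_lt (mul_lt_of_lt_one_left (zero_lt_iff.2 hγ) ha)

theorem val_cyclicBidiagonal_mulVec_sub_lt {d : Fin N → L} (hd : ∀ i, v (d i) < 1)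
    (hy : v (y - 1) < 1) {γ : Γ₀} (hγ : γ ≠ 0) (hu : ∀ i, v (u i) ≤ γ) (i : Fin N) :
    v ((cyclicBidiagonal d y).mulVec u i - u (i + 1)) < γ := by
  rw [cyclicBidiagonal_mulVec, add_sub_assoc, ← sub_one_mul]
  refine v.map_add_lt (val_mul_lt hγ (hd i) (hu i)) (val_mul_lt hγ ?_ (hu _))
  split_ifs
  · exact hy
  · simp

theorem val_cyclicProd_mulVec_sub_lt (hds : ∀ d ∈ ds, ∀ i, v (d i) < 1) (hy : v (y - 1) < 1)
    {γ : Γ₀} (hγ : γ ≠ 0) (hu : ∀ i, v (u i) ≤ γ) (i : Fin N) :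
    v ((cyclicProd ds y).mulVec u i - u (i + ds.length • 1)) < γ := by
  induction ds generalizing i with
  | nil => simpa [cyclicProd] using zero_lt_iff.2 hγ
  | cons d ds ih =>
    specialize ih fun d' hd' => hds d' (List.mem_cons_of_mem d hd')
    have hle (j : Fin N) : v ((cyclicProd ds y).mulVec u j) ≤ γ := by
      rw [← sub_add_cancel ((cyclicProd ds y).mulVec u j)]
      exact v.map_add_le (ih j).le (hu _)
    have hadd : i + (ds.length + 1) • (1 : Fin N) = i + 1 + ds.length • 1 := by
      rw [succ_nsmul', add_assoc]
    have hstep := val_cyclicBidiagonal_mulVec_sub_lt (hds d List.mem_cons_self) hy hγ hle i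
    have hcons : cyclicProd (d :: ds) y = cyclicBidiagonal d y * cyclicProd ds y := List.prod_cons
    rw [hcons, ← Matrix.mulVec_mulVec, List.length_cons, hadd, ← sub_add_sub_cancel]
    exact v.map_add_lt hstep (ih (i + 1))

theorem val_sub_lt_of_mulVec_eq_smul (hds : ∀ d ∈ ds, ∀ i, v (d i) < 1)
    (hm : ds.length.Coprime N) (hx : v (x - 1) < 1) (hy : v (y - 1) < 1)
    (h : (cyclicProd ds y).mulVec u = x • u) {γ : Γ₀} (hγ : γ ≠ 0) (hu : ∀ i, v (u i) ≤ γ)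
    (i : Fin N) : v (u i - u 0) < γ := by
  have hmk (a b : L) : (a : L ⧸ v.ltAddSubgroup (Units.mk0 γ hγ)) = b ↔ v (a - b) < γ :=
    QuotientAddGroup.eq_iff_sub_mem
  have hper : Function.Periodic (fun j => (u j : L ⧸ v.ltAddSubgroup (Units.mk0 γ hγ)))
      (ds.length • 1) := fun j => by
    refine ((hmk _ _).2 ?_).symm
    have hprod := val_cyclicProd_mulVec_sub_lt hds hy hγ hu j
    rw [h, Pi.smul_apply, smul_eq_mul] at hprod
    rw [← sub_sub_sub_cancel_left _ _ (x * u j), ← sub_one_mul]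
    exact v.map_sub_lt hprod (val_mul_lt hγ hx (hu j))
  exact (hmk _ _).1 (eq_apply_zero_of_periodic hm hper i)

theorem val_sub_lt_val_zero_of_mulVec_eq_smul (hds : ∀ d ∈ ds, ∀ i, v (d i) < 1)
    (hm : ds.length.Coprime N) (hx : v (x - 1) < 1) (hy : v (y - 1) < 1) (hu : u ≠ 0)
    (h : (cyclicProd ds y).mulVec u = x • u) (i : Fin N) : v (u i - u 0) < v (u 0) := by
  obtain ⟨i₀, hi₀⟩ := Finite.exists_max fun i => v (u i)
  have hne : v (u i₀) ≠ 0 := fun h0 => hu <| funext fun i =>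
    v.zero_iff.1 (le_zero_iff.1 ((hi₀ i).trans_eq h0))
  have hlt := val_sub_lt_of_mulVec_eq_smul hds hm hx hy h hne hi₀
  have heq : v (u 0) = v (u i₀) := v.map_eq_of_sub_lt (v.map_sub_swap (u i₀) (u 0) ▸ hlt i₀)
  rw [heq]
  exact hlt i

theorem exists_scaling_of_mulVec_eq_smul (hds : ∀ d ∈ ds, ∀ i, v (d i) ≤ 1)
    (hm : ds.length.Coprime N) (hκ0 : κ ≠ 0) (hκ : v κ < 1) (hx : v (x * κ ^ ds.length - 1) < 1)
    (hy : v (y * κ ^ N - 1) < 1) (hw : w ≠ 0) (h : (cyclicProd ds y).mulVec w = x • w) :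
    ∃ c : Lˣ, ∀ i : Fin N, v (c * w i - κ ^ (N - 1 - (i : ℕ))) < v (κ ^ (N - 1 - (i : ℕ))) := by
  have hu : (fun i : Fin N => κ ^ (i : ℕ) * w i) ≠ 0 := fun h0 => hw <| funext fun i =>
    (mul_eq_zero.1 (congrFun h0 i)).resolve_left (pow_ne_zero _ hκ0)
  have hlt := val_sub_lt_val_zero_of_mulVec_eq_smul (v := v) (ds := ds.map (κ • ·)) (by
    simp only [List.forall_mem_map, Pi.smul_apply, smul_eq_mul, map_mul]
    exact fun d hd i => mul_lt_one_of_lt_of_le hκ (hds d hd i)) (by rwa [List.length_map]) hx hy hu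
    (cyclicProd_map_smul_mulVec hκ0 h)
  simp only [Fin.val_zero, pow_zero, one_mul] at hlt
  have hw0 : w 0 ≠ 0 := v.ne_zero_iff.1 (ne_zero_of_lt (hlt 0))
  refine ⟨Units.mk0 (κ ^ (N - 1) / w 0) (div_ne_zero (pow_ne_zero _ hκ0) hw0), fun i => ?_⟩
  have hsplit : κ ^ (N - 1) = κ ^ (N - 1 - (i : ℕ)) * κ ^ (i : ℕ) := by
    rw [← pow_add, Nat.sub_add_cancel (Nat.le_sub_one_of_lt i.isLt)]
  have hdiff : κ ^ (N - 1) / w 0 * w i - κ ^ (N - 1 - (i : ℕ)) =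
      (κ ^ (i : ℕ) * w i - w 0) / w 0 * κ ^ (N - 1 - (i : ℕ)) := by
    rw [hsplit]
    field_simp
  rw [Units.val_mk0, hdiff]
  refine val_mul_lt (v.ne_zero_iff.2 (pow_ne_zero _ hκ0)) ?_ le_rfl
  rw [map_div₀]
  exact (div_lt_one₀ (zero_lt_iff.2 (v.ne_zero_iff.2 hw0))).2 (hlt i)

end Valuation

variable {M K N : ℕ} {I V : ℤ → ℤ → ℂ} {F : ℂ[X][X]}

theorem laxMatrix_map_eq_cyclicProd (s : ℤ) :
    (laxMatrix M K N I V s).map (algebraMap ℂ[X] (RatFun F)) =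
      cyclicProd ((laxDiagonals M K N I V s).map (algebraMap ℂ (RatFun F) ∘ ·)) (yFun F) := by
  rw [laxMatrix_eq_cyclicProd, cyclicProd_map, List.map_map]
  rfl

theorem exists_isEigenvector [IsDomain (AdjoinRoot F)] {Z : Matrix (Fin N) (Fin N) ℂ[X]}
    (hF : F = Z.charpoly) : ∃ w : Fin N → RatFun F, IsEigenvector F Z w := by
  have hdet : (Matrix.scalar (Fin N) (xFun F) - Z.map (algebraMap ℂ[X] (RatFun F))).det = 0 := by
    rw [← Matrix.eval_charpoly, Matrix.charpoly_map, ← hF, eval_map_algebraMap, xFun,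
      aeval_algebraMap_apply, AdjoinRoot.aeval_eq, AdjoinRoot.mk_self, map_zero]
  obtain ⟨w, hw, h⟩ := Matrix.exists_mulVec_eq_zero_iff.2 hdet
  rw [Matrix.sub_mulVec, sub_eq_zero, Matrix.scalar_apply, Matrix.diagonal_const_mulVec] at h
  exact ⟨w, hw, h.symm⟩

theorem IsEigenvector.exists_scaling [NeZero N] [IsDomain (AdjoinRoot F)]
    (hmN : (M + K).Coprime N) {P : CurvePoint F} {κ : (RatFun F)ˣ}
    (hκ : P.HasOrder (κ : RatFun F) 1) (hx : P.LeadingTerm (xFun F) ↑(κ ^ (-((M + K : ℕ) : ℤ))))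
    (hy : P.LeadingTerm (yFun F) ↑(κ ^ (-(N : ℤ)))) {s : ℤ} {w : Fin N → RatFun F}
    (h : IsEigenvector F (laxMatrix M K N I V s) w) :
    ∃ c : (RatFun F)ˣ, ∀ i : Fin N,
      P.LeadingTerm ((c : RatFun F) * w i) ((κ : RatFun F) ^ (N - 1 - (i : ℕ))) := by
  have hlen : ((laxDiagonals M K N I V s).map (algebraMap ℂ (RatFun F) ∘ ·)).length = M + K := by
    rw [List.length_map, length_laxDiagonals]
  rw [CurvePoint.leadingTerm_zpow_neg_iff, ← hlen] at hx
  refine exists_scaling_of_mulVec_eq_smul (v := P.val) ?_ (hlen ▸ hmN) κ.ne_zero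
    (hκ.trans_lt exp_neg_one_lt_one) hx (CurvePoint.leadingTerm_zpow_neg_iff.1 hy) h.1
    (laxMatrix_map_eq_cyclicProd s ▸ h.2)
  simp only [List.forall_mem_map]
  exact fun d _ i => Valuation.IsTrivialOn.valuation_algebraMap_le_one P.val (d i)

end Eigenvectors

end RndKP

end

open RndKP in
theorem proposition2p1 (M K N : ℕ) (hM : 0 < M) (hK : 0 < K) (hN : 0 < N)
    (hMK : Nat.Coprime M K) (hMKN : Nat.Coprime (M + K) N)
    (I V : ℤ → ℤ → ℂ) (hIV : IsSolution M K N I V) (t : ℤ) (F : ℂ[X][X])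
    (hF : F = spectralPoly M K N I V t) (hsmooth : IsSmoothAffine F) :
    -- the points `A_j`, `B_j`; together they are the zeros of `x`, with multiplicity
    (∃ (A : Fin M → CurvePoint F) (B : Fin K → CurvePoint F),
      (∀ j, (A j).IsPointAt 0 ((-1) ^ N * ∏ i : Fin N, I ((i : ℤ) + 1) (-((j : ℤ) * K)))) ∧
      (∀ j, (B j).IsPointAt 0 ((-1) ^ N * ∏ i : Fin N, V ((i : ℤ) + 1) (-((j : ℤ) * M)))) ∧
      ∀ p : CurvePoint F, p.HasValue (xFun F) 0 →
        p.HasOrder (xFun F) (({j | A j = p}.ncard : ℤ) + ({j | B j = p}.ncard : ℤ))) ∧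
    -- the points `Q_j`, which are the zeros of `y`, with multiplicity
    (∃ Q : Fin N → CurvePoint F,
      (∀ (j : Fin N) (s : ℤ), (Q j).IsPointAt
        ((∏ k ∈ Finset.Icc 1 K, V ((j : ℤ) + 1) (s - (k : ℕ))) *
          ∏ k ∈ Finset.Icc 1 M, I ((j : ℤ) + 1) (s - (k : ℕ))) 0) ∧
      ∀ p : CurvePoint F, p.HasValue (yFun F) 0 →
        p.HasOrder (yFun F) ({j | Q j = p}.ncard : ℤ)) ∧
    -- the point `P`, the only point at infinity, and the expansions there
    (∃ P : CurvePoint F,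
      (P.HasPole (xFun F) ∧ P.HasPole (yFun F)) ∧
      (∀ p : CurvePoint F, p.HasPole (xFun F) ∨ p.HasPole (yFun F) → p = P) ∧
      ∃ k : (RatFun F)ˣ,
        P.HasOrder (k : RatFun F) 1 ∧
        P.LeadingTerm (xFun F) ((k ^ (-((M : ℤ) + K)) : (RatFun F)ˣ) : RatFun F) ∧
        P.LeadingTerm (yFun F) ((k ^ (-(N : ℤ)) : (RatFun F)ˣ) : RatFun F) ∧
        ∀ s : ℤ,
          (∃ w : Fin N → RatFun F, IsEigenvector F (laxMatrix M K N I V s) w) ∧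
          ∀ w : Fin N → RatFun F, IsEigenvector F (laxMatrix M K N I V s) w →
            ∃ c : (RatFun F)ˣ, ∀ i : Fin N,
              P.LeadingTerm ((c : RatFun F) * w i) ((k : RatFun F) ^ (N - 1 - (i : ℕ)))) := by
  have : NeZero N := ⟨hN.ne'⟩
  have hm : 0 < M + K := Nat.add_pos_left hM K
  have hFs (s : ℤ) : F = spectralPoly M K N I V s := hF.trans (hIV.spectralPoly_eq hM hK hMK t s)
  obtain rfl : F = cyclicCurve (laxDiagonals M K N I V 0) := by
    rw [hFs 0, spectralPoly, laxMatrix_eq_cyclicProd, cyclicCurve]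
  have hcab : IsCab (M + K) N (cyclicCurve (laxDiagonals M K N I V 0)) := by
    rw [← length_laxDiagonals (I := I) (V := V) (N := N) 0] at hMKN ⊢
    exact isCab_cyclicCurve _ hMKN
  have := hcab.isDomain hN (Nat.cast_ne_zero.2 hN.ne') hMKN
  obtain ⟨Q, hQ, hy⟩ := exists_zeros_yFun_laxDiagonals 0 hm hMKN hsmooth
  obtain ⟨P, hpole, hunique, κ, hκ, hPx, hPy⟩ := hcab.exists_place_at_infinity hm hN hMKN
  refine ⟨exists_zeros_xFun_laxDiagonals hm hMKN hsmooth,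
    ⟨Q, fun j s => hIV.prod_laxDiagonals hK hMK 0 s j ▸ hQ j, hy⟩,
    P, hpole, hunique, κ, hκ, by exact_mod_cast hPx, hPy, fun s =>
      ⟨exists_isEigenvector (hFs s), fun w hw => hw.exists_scaling hMKN hκ hPx hPy⟩⟩
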